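/- **Theorem (the staircase of connectivity).** Let $X\in\mathbb R^{n\times d}$, $y\in\mathbb R^n$, $\beta>0$, and let $L:\mathbb R^n\times\mathbb R^n\to\mathbb R$ be such that $z\mapsto L(z,y)$ is strictly convex on $\mathbb R^n$. For $m\ge 0$ let $\Theta^*(m)\subseteq(\mathbb R^d\times\mathbb R)^m$ be the set of global minimizers $(w_j,\alpha_j)_{j=1}^m$ of $$L\Big(\sum_{j=1}^m (Xw_j)_+\alpha_j,\;y\Big)+\frac\beta2\sum_{j=1}^m\big(\|w_j\|_2^2+\alpha_j^2\big),$$ where $(\cdot)_+$ is the entrywise ReLU. Let $D_1,\dots,D_P$ be the distinct matrices among $\mathrm{diag}(1(Xh\ge 0))$, $h\in\mathbb R^d$, let $\mathcal K_i=\{u\in\mathbb R^d: (2D_i-I)Xu\ge 0\}$, and let $\mathcal P^*$ be the set of optimal solutions $(u_i,v_i)_{i=1}^P$ of the convex reformulation $$\min_{u_i,v_i\in\mathcal K_i}\; L\Big(\sum_{i=1}^P D_iX(u_i-v_i),\;y\Big)+\beta\sum_{i=1}^P\big(\|u_i\|_2+\|v_i\|_2\big).$$ Assume that this problem has an optimal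 solution, i.e. $\mathcal P^*\ne\emptyset$. Let $\mathcal P^*_{\rm irr}$ be the set of $(u_i,v_i)_{i=1}^P\in\mathcal P^*$ for which the indexed family consisting of the vectors $D_iXu_i$ (over $i$ with $u_i\ne0$) and $D_iXv_i$ (over $i$ with $v_i\neq0$) is linearly independent. Put $\mathrm{card}((u_i,v_i)_i)=\sum_{i=1}^P\big(1(u_i\ne0)+1(v_i\ne0)\big)$. Then $\mathrm{card}$ attains a minimum $m^*$ and a maximum $M^*$ on $\mathcal P^*_{\rm irr}$, and the following hold, where a path in a set is a continuous map from $[0,1]$ into that set. 1. If $m=m^*$, then $\Theta^*(m)$ is nonempty and finite; hence no two distinct points of $\Theta^*(m)$ are joined by a path in $\Theta^*(m)$. 2. If $m\ge m^*+1$, there are $A,A'\in\Theta^*(m)$ joined by a path in $\Theta^*(m)$; if $m^*\ge1$, they can be chosen with $A\ne A'$. 3. If $m=M^*$, there is $A\in\Theta^*(m)$ which no path in $\Theta^*(m)$ joins to any other point of $\Theta^*(m)$; if moreover $M^*\ge2$, then $\Theta^*(m)$ is not connected. 4. If $m\ge M^*+1$, every $A=(w_j,\alpha_j)_{j=1}^m\in\Theta^*(m)$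 is joined by a path in $\Theta^*(m)$ to each of its permutations $(w_{\sigma(j)},\alpha_{\sigma(j)})_{j=1}^m$; if $m^*\ge1$, every $A\in\Theta^*(m)$ is joined by a path in $\Theta^*(m)$ to some $A'\in\Theta^*(m)$ with $A'\ne A$. 5. If $m\ge\min\{m^*+M^*,\,n+1\}$, then $\Theta^*(m)$ is path-connected (and nonempty). -/

import Mathlib

open scoped Matrix

noncomputable section

namespace ReLUStaircase

variable {n d : ℕ}

/-- Entrywise ReLU `(z)₊`. -/
def relu (z : Fin n → ℝ) : Fin n → ℝ := fun k => max (z k) 0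

/-- Parameters `(w_j, α_j)_{j < m}` of a width-`m` two-layer scalar-output network on `ℝ^d`. -/
abbrev Params (d m : ℕ) : Type := Fin m → EuclideanSpace ℝ (Fin d) × ℝ

/-- The network output on the data, `∑_j (X w_j)₊ α_j`. -/
def networkFit (X : Matrix (Fin n) (Fin d) ℝ) {m : ℕ} (θ : Params d m) : Fin n → ℝ :=
  ∑ j, (θ j).2 • relu (X *ᵥ (θ j).1.ofLp)

/-- The weight-decay-regularized training objective. -/
def trainingObjective (L : (Fin n → ℝ) → (Fin n → ℝ) → ℝ) (X : Matrix (Fin n) (Fin d) ℝ)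
    (y : Fin n → ℝ) (β : ℝ) {m : ℕ} (θ : Params d m) : ℝ :=
  L (networkFit X θ) y + β / 2 * ∑ j, (‖(θ j).1‖ ^ 2 + (θ j).2 ^ 2)

/-- `Θ*(m)`: the set of global minimizers of the training objective at width `m`. -/
def optimalParams (L : (Fin n → ℝ) → (Fin n → ℝ) → ℝ) (X : Matrix (Fin n) (Fin d) ℝ)
    (y : Fin n → ℝ) (β : ℝ) (m : ℕ) : Set (Params d m) :=
  {θ | ∀ θ' : Params d m, trainingObjective L X y β θ ≤ trainingObjective L X y β θ'}

/-- The pattern `diag(1(X h ≥ 0))` of a vector `h`. -/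
def arrangement (X : Matrix (Fin n) (Fin d) ℝ) (h : EuclideanSpace ℝ (Fin d)) :
    Matrix (Fin n) (Fin n) ℝ :=
  Matrix.diagonal fun k => if 0 ≤ (X *ᵥ h.ofLp) k then 1 else 0

/-- The set `{D_1, …, D_P}` of all (distinct) arrangement patterns of the data matrix. -/
def patterns (X : Matrix (Fin n) (Fin d) ℝ) : Set (Matrix (Fin n) (Fin n) ℝ) :=
  Set.range (arrangement X)

theorem patterns_finite (X : Matrix (Fin n) (Fin d) ℝ) : (patterns X).Finite := by
  refine (Set.finite_range fun s : Fin n → Bool =>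
    Matrix.diagonal fun k => if s k then (1 : ℝ) else 0).subset ?_
  rintro _ ⟨h, rfl⟩
  exact ⟨fun k => decide (0 ≤ (X *ᵥ h.ofLp) k), by simp [arrangement]⟩

instance (X : Matrix (Fin n) (Fin d) ℝ) : Fintype (patterns X) := (patterns_finite X).fintype

/-- The cone `K_i = {u | (2 D_i - I) X u ≥ 0}`. -/
def patternCone (X : Matrix (Fin n) (Fin d) ℝ) (D : Matrix (Fin n) (Fin n) ℝ) :
    Set (EuclideanSpace ℝ (Fin d)) :=
  {u | 0 ≤ (((2 : ℝ) • D - 1) * X) *ᵥ u.ofLp}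

/-- Variables `(u_i, v_i)_{i ∈ [P]}` of the convex reformulation; `(p i).1 = u_i`,
`(p i).2 = v_i`. -/
abbrev ConvexVars (X : Matrix (Fin n) (Fin d) ℝ) : Type :=
  patterns X → EuclideanSpace ℝ (Fin d) × EuclideanSpace ℝ (Fin d)

/-- Feasibility: `u_i, v_i ∈ K_i` for all `i`. -/
def IsFeasible (X : Matrix (Fin n) (Fin d) ℝ) (p : ConvexVars X) : Prop :=
  ∀ i, (p i).1 ∈ patternCone X i.1 ∧ (p i).2 ∈ patternCone X i.1

/-- The objective of the cone-constrained group LASSO. -/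
def convexObjective (L : (Fin n → ℝ) → (Fin n → ℝ) → ℝ) (X : Matrix (Fin n) (Fin d) ℝ)
    (y : Fin n → ℝ) (β : ℝ) (p : ConvexVars X) : ℝ :=
  L (∑ i, (i.1 * X) *ᵥ ((p i).1 - (p i).2).ofLp) y + β * ∑ i, (‖(p i).1‖ + ‖(p i).2‖)

/-- `P*`: the optimal set of the convex reformulation. -/
def convexOptimal (L : (Fin n → ℝ) → (Fin n → ℝ) → ℝ) (X : Matrix (Fin n) (Fin d) ℝ)
    (y : Fin n → ℝ) (β : ℝ) : Set (ConvexVars X) :=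
  {p | IsFeasible X p ∧
    ∀ q : ConvexVars X, IsFeasible X q → convexObjective L X y β p ≤ convexObjective L X y β q}

open Classical in
/-- Cardinality `∑_i 1(u_i ≠ 0) + 1(v_i ≠ 0)`. -/
def card {X : Matrix (Fin n) (Fin d) ℝ} (p : ConvexVars X) : ℕ :=
  ∑ i, ((if (p i).1 ≠ 0 then 1 else 0) + (if (p i).2 ≠ 0 then 1 else 0))

/-- All the blocks `u_i` (left) and `v_i` (right) as one family. -/
def block {X : Matrix (Fin n) (Fin d) ℝ} (p : ConvexVars X) :
    patterns X ⊕ patterns X → EuclideanSpace ℝ (Fin d) :=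
  Sum.elim (fun i => (p i).1) (fun i => (p i).2)

/-- The vectors `D_i X u_i` (left) and `D_i X v_i` (right). -/
def blockFit {X : Matrix (Fin n) (Fin d) ℝ} (p : ConvexVars X) :
    patterns X ⊕ patterns X → (Fin n → ℝ) :=
  Sum.elim (fun i => (i.1 * X) *ᵥ (p i).1.ofLp) (fun i => (i.1 * X) *ᵥ (p i).2.ofLp)

/-- `P*_irr`: optimal solutions for which the family `{D_i X u_i}_{u_i ≠ 0} ∪ {D_i X v_i}_{v_i ≠ 0}`
is linearly independent. -/
def irreducibleOptimal (L : (Fin n → ℝ) → (Fin n → ℝ) → ℝ) (X : Matrix (Fin n) (Fin d) ℝ)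
    (y : Fin n → ℝ) (β : ℝ) : Set (ConvexVars X) :=
  {p | p ∈ convexOptimal L X y β ∧
    LinearIndependent ℝ (fun k : {k : patterns X ⊕ patterns X // block p k ≠ 0} => blockFit p k)}

/-- `m*`: the least cardinality of an irreducible optimal solution. -/
def minWidth (L : (Fin n → ℝ) → (Fin n → ℝ) → ℝ) (X : Matrix (Fin n) (Fin d) ℝ)
    (y : Fin n → ℝ) (β : ℝ) : ℕ :=
  sInf (card '' irreducibleOptimal L X y β)

/-- `M*`: the greatest cardinality of an irreducible optimal solution. -/
def maxWidth (L : (Fin n → ℝ) → (Fin n → ℝ) → ℝ) (X : Matrix (Fin n) (Fin d) ℝ)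
    (y : Fin n → ℝ) (β : ℝ) : ℕ :=
  sSup (card '' irreducibleOptimal L X y β)

end ReLUStaircase

end

open scoped Matrix

noncomputable section

namespace ReLUStaircase


/-! By strict convexity all optimal solutions of the convex program share one fit `z`, hence one
total norm. Equality in the triangle inequality at midpoints then puts each block of all of them on
a common ray. So `P*` is a polytope: the weights `c ≥ 0` on the active directions (atoms) with `∑ c
a • f a = z`. The total norm takes care of itself, since every linear relation among the `f a` has
coefficient sum zero (`ConeLasso.sum_eq_zero`). Irreducible solutions are the basic representations,
that is, the vertices.

Merging the neurons of a network by sign and activation pattern keeps the fit and does not raise the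
cost. Equality forces each neuron to be balanced (`‖w‖ = |α|`) and to point along an atom. Hence for
`m ≥ m*` the set `Θ*(m)` is a finite union of pieces, one for each assignment of atoms to the `m`
slots; a piece is the continuous image of a polytope of weights (`optimalParams_eq_configs`).

The staircase is then combinatorial. Each piece is path-connected and contains a vertex. At width
`m*` each vertex fills all slots, so pieces are points. At width `M*` a vertex filling all slots is
isolated. Beyond `M*` every vertex leaves a slot empty; an empty slot can change type freely, so
neurons can be moved through it and all permutations are reached. Two vertices whose supports
together fit into `m` slots lie, up to permutation, in one piece. This connects everything to a
smallest vertex when `m ≥ m* + M*`; when `m ≥ n + 1` a simplex walk works instead, because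
neighbouring vertices use at most `n + 1` atoms together (`IsBasic.exists_pivot`). -/

/-! ### Conic representations: Carathéodory's theorem and simplex pivots. -/

/-- The ratio test: moving from `w` in the direction `r` until a first coordinate vanishes. -/
theorem exists_step {κ : Type*} (A : Finset κ) (w r : κ → ℝ) (hw : ∀ j ∈ A, 0 ≤ w j)
    (hpos : ∀ j ∈ A, r j < 0 → 0 < w j) (hneg : ∃ j ∈ A, r j < 0) :
    ∃ t : ℝ, 0 < t ∧ (∀ j ∈ A, 0 ≤ w j + t * r j) ∧ ∃ j ∈ A, r j < 0 ∧ w j + t * r j = 0 := by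
  classical
  obtain ⟨j₁, hj₁, hr₁⟩ := hneg
  obtain ⟨j₀, hj₀, hmin⟩ := (A.filter fun j => r j < 0).exists_min_image
    (fun j => w j / (- r j)) ⟨j₁, by simp [hj₁, hr₁]⟩
  rw [Finset.mem_filter] at hj₀
  obtain ⟨hA, hr⟩ := hj₀
  have hr' : 0 < - r j₀ := by linarith
  refine ⟨w j₀ / (- r j₀), div_pos (hpos _ hA hr) hr', fun j hj => ?_, j₀, hA, hr, ?_⟩
  · rcases lt_or_ge (r j) 0 with h | h
    · have := hmin j (by simp [hj, h])
      rw [le_div_iff₀ (by linarith)] at this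
      linarith
    · have := hw j hj
      have := (div_pos (hpos _ hA hr) hr').le
      positivity
  · rw [div_neg, neg_mul, div_mul_cancel₀ _ hr.ne]
    ring

section Conic

variable {ι κ V : Type*} [Fintype κ] [AddCommGroup V] [Module ℝ V]

/-- The nonnegative coefficient vectors representing `z` by the family `f`. -/
def conicReps (f : κ → V) (z : V) : Set (κ → ℝ) :=
  {w | (∀ j, 0 ≤ w j) ∧ ∑ j, w j • f j = z}

/-- A conic representation is basic if the vectors it uses are linearly independent. -/
def IsBasic (f : κ → V) (z : V) (w : κ → ℝ) : Prop :=
  w ∈ conicReps f z ∧ LinearIndepOn ℝ f (Function.support w)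

theorem convex_conicReps (f : κ → V) (z : V) : Convex ℝ (conicReps f z) := by
  rintro w ⟨hw0, hw⟩ w' ⟨hw0', hw'⟩ s t hs ht hst
  refine ⟨fun j => ?_, ?_⟩
  · have := hw0 j
    have := hw0' j
    simp only [Pi.add_apply, Pi.smul_apply, smul_eq_mul]
    positivity
  · simp only [Pi.add_apply, Pi.smul_apply, smul_eq_mul, add_smul, mul_smul,
      Finset.sum_add_distrib, ← Finset.smul_sum, hw, hw']
    rw [← add_smul, hst, one_smul]

theorem linearIndepOn_iff_of_fintype {f : κ → V} {s : Set κ} :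
    LinearIndepOn ℝ f s ↔
      ∀ r : κ → ℝ, (∀ j ∉ s, r j = 0) → ∑ j, r j • f j = 0 → r = 0 := by
  rw [linearIndepOn_iff]
  constructor
  · intro h r hr h0
    have := h (Finsupp.equivFunOnFinite.symm r) (by
      rw [Finsupp.mem_supported']
      exact fun j hj => hr j hj) (by
      rw [Finsupp.linearCombination_apply, Finsupp.sum_fintype _ _ (by simp)]
      simpa using h0)
    ext j
    exact DFunLike.congr_fun this j
  · intro h l hl h0
    rw [Finsupp.mem_supported'] at hl
    rw [Finsupp.linearCombination_apply, Finsupp.sum_fintype _ _ (by simp)] at h0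
    ext j
    exact congrFun (h l hl h0) j

theorem eq_of_linearIndepOn {f : κ → V} {s : Set κ} (hf : LinearIndepOn ℝ f s) {w w' : κ → ℝ}
    (hw : ∀ j ∉ s, w j = 0) (hw' : ∀ j ∉ s, w' j = 0)
    (h : ∑ j, w j • f j = ∑ j, w' j • f j) : w = w' := by
  refine sub_eq_zero.1 (linearIndepOn_iff_of_fintype.1 hf (w - w') (fun j hj => ?_) ?_)
  · simp [hw j hj, hw' j hj]
  · simp [sub_smul, h]

/-- Carathéodory's theorem for cones. -/
theorem exists_isBasic {f : κ → V} {z : V} (h : (conicReps f z).Nonempty) :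
    ∃ w, IsBasic f z w := by
  classical
  -- A representation of minimal support is basic: along a dependency, the ratio test would remove
  -- one more vector.
  obtain ⟨w, hw, hmin⟩ := (measure fun w : κ → ℝ =>
    (Finset.univ.filter fun j => w j ≠ 0).card).wf.has_min _ h
  refine ⟨w, hw, ?_⟩
  by_contra hdep
  rw [linearIndepOn_iff_of_fintype] at hdep
  push Not at hdep
  have : ∃ r : κ → ℝ, (∀ j ∉ Function.support w, r j = 0) ∧ ∑ j, r j • f j = 0 ∧
      ∃ j, r j < 0 := by
    obtain ⟨r, h1, h2, h3⟩ := hdep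
    obtain ⟨j, hj⟩ := Function.ne_iff.1 h3
    rcases lt_or_gt_of_ne hj with h | h
    · exact ⟨r, h1, h2, j, h⟩
    · exact ⟨-r, fun i hi => by simp [h1 i hi], by simp [h2], j, by simpa using h⟩
  obtain ⟨r, hr, hr0, j₁, hj₁⟩ := this
  have hpos : ∀ j, r j ≠ 0 → 0 < w j := fun j hj =>
    lt_of_le_of_ne (hw.1 j) fun h0 => hj (hr j (by simp [← h0]))
  obtain ⟨t, -, hnn, j₀, -, hlt, hz⟩ := exists_step Finset.univ w r (fun j _ => hw.1 j)
    (fun j _ hj => hpos j hj.ne) ⟨j₁, Finset.mem_univ _, hj₁⟩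
  refine hmin (w + t • r) ⟨fun j => by simpa using hnn j (Finset.mem_univ _), ?_⟩ ?_
  · simp only [Pi.add_apply, Pi.smul_apply, smul_eq_mul, add_smul, mul_smul,
      Finset.sum_add_distrib, ← Finset.smul_sum, hr0, hw.2, smul_zero, add_zero]
  · refine Finset.card_lt_card (Finset.ssubset_iff_of_subset (fun j => ?_) |>.2 ⟨j₀, ?_, ?_⟩)
    · simp only [Finset.mem_filter, Finset.mem_univ, true_and, Pi.add_apply, Pi.smul_apply,
        smul_eq_mul]
      intro hj h0
      exact hj (by rw [h0, hr j (by simp [h0])]; simp)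
    · simpa using (hpos _ hlt.ne).ne'
    · simpa using hz

theorem finite_isBasic (f : κ → V) (z : V) : {w | IsBasic f z w}.Finite := by
  refine Set.Finite.of_finite_image (f := Function.support) (Set.toFinite _) ?_
  intro w hw w' hw' h
  refine eq_of_linearIndepOn hw.2 (fun j hj => ?_) (fun j hj => ?_) (hw.1.2.trans hw'.1.2.symm)
  · simpa using hj
  · rw [h] at hj
    simpa using hj

theorem IsBasic.ncard_le [FiniteDimensional ℝ V] {f : κ → V} {z : V} {w : κ → ℝ}
    (hw : IsBasic f z w) : (Function.support w).ncard ≤ Module.finrank ℝ V := by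
  classical
  have := hw.2.linearIndependent.fintype_card_le_finrank
  rwa [← Nat.card_eq_fintype_card, Nat.card_coe_set_eq] at this

/-- A simplex pivot: from a basic representation `w`, a neighbouring basic representation
carries strictly less weight outside the support of a given other basic representation. -/
theorem IsBasic.exists_pivot [FiniteDimensional ℝ V] {f : κ → V} {z : V} {w w' : κ → ℝ}
    (hw : IsBasic f z w) (hw' : IsBasic f z w') (hne : w ≠ w') {S : Finset κ}
    (hS : ∀ j, j ∈ S ↔ w' j = 0) :
    ∃ w'', IsBasic f z w'' ∧ ∑ j ∈ S, w'' j < ∑ j ∈ S, w j ∧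
      (Function.support w ∪ Function.support w'').ncard ≤ Module.finrank ℝ V + 1 := by
  classical
  let ψ : (κ → ℝ) → ℝ := fun r => ∑ j ∈ S, r j
  have hψ : ∀ (r q : κ → ℝ) (t : ℝ), ψ (r + t • q) = ψ r + t * ψ q := fun r q t => by
    simp [ψ, Finset.sum_add_distrib, Finset.mul_sum]
  have hfit : ∀ (r q : κ → ℝ) (t : ℝ), ∑ j, (r + t • q) j • f j =
      ∑ j, r j • f j + t • ∑ j, q j • f j := fun r q t => by
    simp [add_smul, mul_smul, Finset.sum_add_distrib, Finset.smul_sum]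
  -- If `w` had no weight outside the support of `w'`, both would be representations over one
  -- independent family, hence equal.
  have hψw : 0 < ψ w := by
    refine lt_of_le_of_ne (Finset.sum_nonneg fun j _ => hw.1.1 j) fun h0 => hne ?_
    have h0' := (Finset.sum_eq_zero_iff_of_nonneg fun j _ => hw.1.1 j).1 h0.symm
    exact eq_of_linearIndepOn hw'.2 (fun j hj => h0' j ((hS j).2 (by simpa using hj)))
      (fun j hj => by simpa using hj) (hw.1.2.trans hw'.1.2.symm)
  let R : Set (κ → ℝ) := {r | (∀ j, w j = 0 → 0 ≤ r j) ∧ ∑ j, r j • f j = 0 ∧ ψ r < 0}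
  have hR : R.Nonempty := by
    refine ⟨w' + (-1 : ℝ) • w, fun j hj => ?_, ?_, ?_⟩
    · simpa [hj] using hw'.1.1 j
    · rw [hfit, hw.1.2, hw'.1.2]
      simp
    · have : ψ w' = 0 := Finset.sum_eq_zero fun j hj => (hS j).1 hj
      rw [hψ, this]
      linarith
  -- Among the feasible directions that decrease `ψ` (there is one, `w' - w`), take one entering the
  -- fewest coordinates outside the support of `w`.
  obtain ⟨r, ⟨hr, hr0, hrψ⟩, hmin⟩ := (measure fun r : κ → ℝ =>
    (Finset.univ.filter fun j => w j = 0 ∧ r j ≠ 0).card).wf.has_min _ hR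
  -- Relations supported on `U` (the supports of `w` and `r`) are determined by `ψ`: if `ψ q = 0`
  -- with `q ≠ 0`, moving `r` along `q` or `-q` would cancel an entering coordinate and contradict
  -- minimality.
  have key : ∀ q : κ → ℝ, (∀ j, w j = 0 → r j = 0 → q j = 0) → ∑ j, q j • f j = 0 → ψ q = 0 →
      q = 0 := by
    intro q hq hq0 hqψ
    by_contra hqne
    obtain ⟨j₁, hj₁, hqj₁⟩ : ∃ j, w j = 0 ∧ q j ≠ 0 := by
      by_contra! hcon
      exact hqne (linearIndepOn_iff_of_fintype.1 hw.2 q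
        (fun j hj => hcon j (by simpa using hj)) hq0)
    obtain ⟨q, hq, hq0, hqψ, hqj₁⟩ : ∃ q : κ → ℝ, (∀ j, w j = 0 → r j = 0 → q j = 0) ∧
        ∑ j, q j • f j = 0 ∧ ψ q = 0 ∧ q j₁ < 0 := by
      rcases lt_or_gt_of_ne hqj₁ with h | h
      · exact ⟨q, hq, hq0, hqψ, h⟩
      · refine ⟨-q, fun i hi hi' => by simp [hq i hi hi'], by simp [hq0], ?_, by simpa using h⟩
        simpa [ψ] using hqψ
    obtain ⟨t, -, hnn, j₀, hj₀, hlt, hz⟩ := exists_step (Finset.univ.filter fun j => w j = 0) r q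
      (fun j hj => hr j (by simpa using hj))
      (fun j hj hqj => lt_of_le_of_ne (hr j (by simpa using hj)) fun h0 =>
        hqj.ne (hq j (by simpa using hj) h0.symm))
      ⟨j₁, by simpa using hj₁, hqj₁⟩
    refine hmin (r + t • q) ⟨fun j hj => by simpa using hnn j (by simpa using hj), ?_, ?_⟩ ?_
    · rw [hfit, hr0, hq0]
      simp
    · rw [hψ, hqψ]
      simpa using hrψ
    · have hj₀' : w j₀ = 0 := by simpa using hj₀
      refine Finset.card_lt_card (Finset.ssubset_iff_of_subset (fun j => ?_) |>.2 ⟨j₀, ?_, ?_⟩)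
      · simp only [Finset.mem_filter, Finset.mem_univ, true_and, Pi.add_apply, Pi.smul_apply,
          smul_eq_mul]
        rintro ⟨hj, hj'⟩
        exact ⟨hj, fun h0 => hj' (by rw [h0, hq j hj h0]; simp)⟩
      · simpa [hj₀'] using fun h0 => hlt.ne (hq j₀ hj₀' h0)
      · simp [hz]
  obtain ⟨j₁, -, hj₁⟩ : ∃ j ∈ S, r j < 0 := by
    by_contra! hcon
    exact hrψ.not_ge (Finset.sum_nonneg hcon)
  have hpos : ∀ j, r j < 0 → 0 < w j := fun j hj =>
    lt_of_le_of_ne (hw.1.1 j) fun h0 => hj.not_ge (hr j h0.symm)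
  obtain ⟨t, ht, hnn, j₀, -, hlt, hz⟩ := exists_step Finset.univ w r (fun j _ => hw.1.1 j)
    (fun j _ => hpos j) ⟨j₁, Finset.mem_univ _, hj₁⟩
  let U : Finset κ := Finset.univ.filter fun j => w j ≠ 0 ∨ r j ≠ 0
  have hU : ∀ j, j ∉ U → w j = 0 ∧ r j = 0 := fun j hj => by
    simpa [U, not_or] using hj
  -- By `key` every relation on `U` is a multiple of `r`, and `r j₀ ≠ 0`, so dropping the leaving
  -- index `j₀` leaves an independent family. This also bounds `U` by the dimension plus one.
  have hli : LinearIndepOn ℝ f (U.erase j₀ : Finset κ) := by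
    refine linearIndepOn_iff_of_fintype.2 fun q hq hq0 => ?_
    have h1 : q + (- (ψ q / ψ r)) • r = 0 := by
      refine key _ (fun j hj hj' => ?_) ?_ ?_
      · have : q j = 0 := hq j (by simp [U, hj, hj'])
        simp [this, hj']
      · rw [hfit, hq0, hr0]
        simp
      · rw [hψ]
        field_simp [hrψ.ne]
        ring
    have h2 := congrFun h1 j₀
    simp only [Pi.add_apply, Pi.smul_apply, smul_eq_mul, Pi.zero_apply, hq j₀ (by simp),
      zero_add, mul_eq_zero, hlt.ne, or_false] at h2
    simpa [h2] using h1
  have hsub : Function.support (w + t • r) ⊆ (U.erase j₀ : Finset κ) := by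
    intro j hj
    rw [Finset.mem_coe, Finset.mem_erase]
    refine ⟨fun h => hj (by simpa [h] using hz), ?_⟩
    by_contra h
    exact hj (by simp [hU j h])
  refine ⟨w + t • r, ⟨⟨fun j => by simpa using hnn j (Finset.mem_univ _), ?_⟩,
    hli.mono hsub⟩, ?_, ?_⟩
  · rw [hfit, hr0, hw.1.2]
    simp
  · have := hψ w r t
    have := mul_neg_of_pos_of_neg ht hrψ
    change ψ _ < ψ _
    linarith
  · have h1 : (U.erase j₀).card ≤ Module.finrank ℝ V := by
      have := hli.linearIndependent.fintype_card_le_finrank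
      rwa [← Nat.card_eq_fintype_card, Nat.card_coe_set_eq, Set.ncard_coe_finset] at this
    have h2 : Function.support w ∪ Function.support (w + t • r) ⊆ (U : Set κ) := by
      refine Set.union_subset (fun j hj => ?_) (hsub.trans ?_)
      · simp only [U, Finset.coe_filter, Finset.mem_univ, true_and, Set.mem_ofPred_eq]
        exact Or.inl hj
      · exact_mod_cast Finset.erase_subset _ _
    have h3 := Set.ncard_le_ncard h2
    rw [Set.ncard_coe_finset] at h3
    have := Finset.pred_card_le_card_erase (s := U) (a := j₀)
    omega

end Conic


/-! ### Configurations of neurons and the paths between them. -/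

/-- Neurons of type `a : ι` with weight `w ≥ 0` are points `curve a w` of `Y`, contributing
`w • fit a` to the output. -/
structure NeuronModel (ι V Y : Type*) [Fintype ι] [NormedAddCommGroup V] [NormedSpace ℝ V]
    [TopologicalSpace Y] [Zero Y] where
  fit : ι → V
  curve : ι → ℝ → Y
  output : Y → V
  continuous_curve : ∀ a, Continuous (curve a)
  curve_zero : ∀ a, curve a 0 = 0
  output_curve : ∀ a w, 0 ≤ w → output (curve a w) = w • fit a
  sum_eq_zero : ∀ r : ι → ℝ, ∑ a, r a • fit a = 0 → ∑ a, r a = 0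

namespace NeuronModel

open Function

section Total

variable {ι : Type*} {m : ℕ}

/-- The total weight of each neuron type. -/
def total (s : Fin m → ι) (w : Fin m → ℝ) : ι → ℝ :=
  open Classical in fun a => ∑ j with s j = a, w j

theorem total_apply {s : Fin m → ι} {w : Fin m → ℝ} (hs : Set.InjOn s (support w)) {j : Fin m}
    (hj : w j ≠ 0) : total s w (s j) = w j := by
  classical
  rw [total, Finset.sum_eq_single_of_mem j (by simp)]
  intro i hi hij
  by_contra h
  exact hij (hs h hj (by simpa using hi))

theorem support_total {s : Fin m → ι} {w : Fin m → ℝ} (hw : ∀ j, 0 ≤ w j) :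
    support (total s w) = s '' support w := by
  classical
  ext a
  rw [mem_support, total, Ne, Finset.sum_eq_zero_iff_of_nonneg fun j _ => hw j]
  simp [and_comm]

theorem ncard_support_total {s : Fin m → ι} {w : Fin m → ℝ} (hw : ∀ j, 0 ≤ w j)
    (hs : Set.InjOn s (support w)) : (support (total s w)).ncard = (support w).ncard := by
  rw [support_total hw, hs.ncard_image]

end Total

variable {ι V Y : Type*} [Fintype ι] [NormedAddCommGroup V] [NormedSpace ℝ V]
  [TopologicalSpace Y] [Zero Y] (N : NeuronModel ι V Y) {z : V} {m : ℕ}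

/-- The configuration with neuron types `s` and weights `w`. -/
def params (s : Fin m → ι) (w : Fin m → ℝ) : Fin m → Y := fun j => N.curve (s j) (w j)

/-- All configurations of `m` neurons with total output `z`. -/
def configs (z : V) (m : ℕ) : Set (Fin m → Y) :=
  ⋃ s : Fin m → ι, N.params s '' conicReps (N.fit ∘ s) z

theorem params_mem {s : Fin m → ι} {w : Fin m → ℝ} (hw : w ∈ conicReps (N.fit ∘ s) z) :
    N.params s w ∈ N.configs z m :=
  Set.mem_iUnion.2 ⟨s, w, hw, rfl⟩

theorem exists_of_mem {θ : Fin m → Y} (hθ : θ ∈ N.configs z m) :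
    ∃ s, ∃ w ∈ conicReps (N.fit ∘ s) z, N.params s w = θ :=
  Set.mem_iUnion.1 hθ

theorem continuous_params (s : Fin m → ι) : Continuous (N.params s) :=
  continuous_pi fun j => (N.continuous_curve (s j)).comp (continuous_apply j)

/-- A vanishing fit would be a relation with coefficient sum one. -/
theorem fit_ne_zero (a : ι) : N.fit a ≠ 0 := fun h => by
  classical
  simpa using N.sum_eq_zero (Pi.single a 1) (by
    rw [Finset.sum_eq_single a] <;> simp +contextual [h])

theorem curve_eq_zero_iff (a : ι) {w : ℝ} (hw : 0 ≤ w) : N.curve a w = 0 ↔ w = 0 := by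
  refine ⟨fun h => ?_, fun h => h ▸ N.curve_zero a⟩
  have h0 : N.output 0 = 0 := by simpa [N.curve_zero] using N.output_curve a 0 le_rfl
  have := N.output_curve a w hw
  rw [h, h0] at this
  simpa [N.fit_ne_zero a] using this.symm

theorem sum_total {M : Type*} [AddCommGroup M] [Module ℝ M] (g : ι → M) (s : Fin m → ι)
    (w : Fin m → ℝ) : ∑ a, total s w a • g a = ∑ j, w j • g (s j) := by
  classical
  rw [← Finset.sum_fiberwise Finset.univ s]
  refine Finset.sum_congr rfl fun a _ => ?_
  rw [total, Finset.sum_smul]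
  exact Finset.sum_congr (by congr) fun j hj => by rw [(Finset.mem_filter.1 hj).2]

theorem sum_eq_zero_comp (s : Fin m → ι) {r : Fin m → ℝ}
    (hr : ∑ j, r j • (N.fit ∘ s) j = 0) : ∑ j, r j = 0 := by
  have h := N.sum_eq_zero (total s r) (by simpa [sum_total] using hr)
  simpa [h] using (sum_total (fun _ => (1 : ℝ)) s r).symm

/-- All representations have the same total weight, because relations have coefficient sum zero;
this total bounds each coordinate. -/
theorem isCompact_conicReps (s : Fin m → ι) : IsCompact (conicReps (N.fit ∘ s) z) := by
  rcases (conicReps (N.fit ∘ s) z).eq_empty_or_nonempty with h | ⟨w₀, hw₀⟩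
  · simp [h]
  have hcl : IsClosed (conicReps (N.fit ∘ s) z) := by
    have : conicReps (N.fit ∘ s) z =
        (⋂ j, {w | 0 ≤ w j}) ∩ {w | ∑ j, w j • (N.fit ∘ s) j = z} := by
      ext w
      simp [conicReps]
    rw [this]
    refine (isClosed_iInter fun j => isClosed_le continuous_const (continuous_apply j)).inter ?_
    exact isClosed_eq (by fun_prop) continuous_const
  refine (isCompact_Icc (a := (0 : Fin m → ℝ)) (b := fun _ => ∑ j, w₀ j)).of_isClosed_subset hcl ?_
  intro w hw
  refine ⟨fun j => hw.1 j, fun j => ?_⟩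
  have := N.sum_eq_zero_comp s (r := w - w₀) (by simp [sub_smul, -Function.comp_apply, hw.2, hw₀.2])
  simp only [Pi.sub_apply, Finset.sum_sub_distrib, sub_eq_zero] at this
  rw [← this]
  exact Finset.single_le_sum (fun j _ => hw.1 j) (Finset.mem_univ j)

theorem joinedIn_params {s : Fin m → ι} {w w' : Fin m → ℝ} (hw : w ∈ conicReps (N.fit ∘ s) z)
    (hw' : w' ∈ conicReps (N.fit ∘ s) z) :
    JoinedIn (N.configs z m) (N.params s w) (N.params s w') :=
  ((((convex_conicReps (N.fit ∘ s) z).isPathConnected ⟨w, hw⟩).joinedIn w hw w' hw').map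
    (N.continuous_params s)).mono (Set.subset_iUnion_of_subset s subset_rfl)

theorem params_congr {s s' : Fin m → ι} {w : Fin m → ℝ} (h : ∀ j, w j ≠ 0 → s j = s' j) :
    N.params s w = N.params s' w := by
  funext j
  by_cases hj : w j = 0
  · simp [params, hj, N.curve_zero]
  · simp [params, h j hj]

theorem conicReps_congr {s s' : Fin m → ι} {w : Fin m → ℝ} (h : ∀ j, w j ≠ 0 → s j = s' j)
    (hw : w ∈ conicReps (N.fit ∘ s) z) : w ∈ conicReps (N.fit ∘ s') z := by
  refine ⟨hw.1, hw.2 ▸ Finset.sum_congr rfl fun j _ => ?_⟩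
  by_cases hj : w j = 0
  · simp [hj]
  · simp [h j hj]

theorem comp_perm_mem {θ : Fin m → Y} (hθ : θ ∈ N.configs z m) (σ : Equiv.Perm (Fin m)) :
    θ ∘ σ ∈ N.configs z m := by
  obtain ⟨s, w, hw, rfl⟩ := N.exists_of_mem hθ
  refine N.params_mem (s := s ∘ σ) (w := w ∘ σ) ⟨fun j => hw.1 _, ?_⟩
  rw [← hw.2]
  exact Equiv.sum_comp σ fun j => w j • (N.fit ∘ s) j

theorem joinedIn_comp_of_joinedIn {θ θ' : Fin m → Y} (h : JoinedIn (N.configs z m) θ θ')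
    (σ : Equiv.Perm (Fin m)) : JoinedIn (N.configs z m) (θ ∘ σ) (θ' ∘ σ) := by
  refine (h.map (f := fun θ => θ ∘ σ) (by fun_prop)).mono ?_
  rintro _ ⟨θ, hθ, rfl⟩
  exact N.comp_perm_mem hθ σ

/-- A neuron can be moved to an unused slot. -/
theorem joinedIn_swap_of_eq_zero {θ : Fin m → Y} (hθ : θ ∈ N.configs z m) {k : Fin m}
    (hk : θ k = 0) (i : Fin m) : JoinedIn (N.configs z m) θ (θ ∘ Equiv.swap i k) := by
  obtain ⟨s, w, hw, rfl⟩ := N.exists_of_mem hθ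
  replace hk : w k = 0 := (N.curve_eq_zero_iff _ (hw.1 k)).1 hk
  -- The type of an empty slot is immaterial. Giving slot `k` the type of slot `i` puts the
  -- configuration before and after the move into one convex piece.
  have h1 : ∀ j, w j ≠ 0 → s j = update s k (s i) j := fun j hj => by
    rw [update_of_ne (by rintro rfl; exact hj hk)]
  have h2 : ∀ j, (w ∘ Equiv.swap i k) j ≠ 0 →
      (s ∘ Equiv.swap i k) j = update s k (s i) j := fun j hj => by
    rcases eq_or_ne j k with rfl | hjk
    · simp
    · have hji : j ≠ i := by
        rintro rfl
        simp [hk] at hj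
      simp [Equiv.swap_apply_of_ne_of_ne hji hjk, hjk]
  have h3 : N.params s w ∘ Equiv.swap i k =
      N.params (s ∘ Equiv.swap i k) (w ∘ Equiv.swap i k) := rfl
  rw [h3, N.params_congr h1, N.params_congr h2]
  refine N.joinedIn_params (N.conicReps_congr h1 hw) (N.conicReps_congr h2 ⟨fun j => hw.1 _, ?_⟩)
  rw [← hw.2]
  exact Equiv.sum_comp (Equiv.swap i k) fun j => w j • (N.fit ∘ s) j

theorem joinedIn_swap {θ : Fin m → Y} (hθ : θ ∈ N.configs z m) {k : Fin m}
    (hk : θ k = 0) (i j : Fin m) : JoinedIn (N.configs z m) θ (θ ∘ Equiv.swap i j) := by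
  rcases eq_or_ne i j with rfl | hij
  · simpa using JoinedIn.refl hθ
  rcases eq_or_ne j k with rfl | hjk
  · exact N.joinedIn_swap_of_eq_zero hθ hk i
  rcases eq_or_ne i k with rfl | hik
  · rw [Equiv.swap_comm]
    exact N.joinedIn_swap_of_eq_zero hθ hk j
  -- The empty slot `k` serves as temporary storage: `i` moves to `k`, `j` to `i`, and the stored
  -- neuron to `j`.
  have h1 := N.joinedIn_swap_of_eq_zero hθ hk i
  have h2 := N.joinedIn_swap_of_eq_zero h1.target_mem (k := i) (by simpa using hk) j
  have h3 := N.joinedIn_swap_of_eq_zero h2.target_mem (k := j) (by simpa using hk) k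
  have : ((θ ∘ Equiv.swap i k) ∘ Equiv.swap j i) ∘ Equiv.swap k j = θ ∘ Equiv.swap i j := by
    funext l
    simp only [comp_apply, Equiv.swap_apply_def]
    congr 1
    grind
  rw [this] at h3
  exact (h1.trans h2).trans h3

theorem joinedIn_comp_perm_of_eq_zero (σ : Equiv.Perm (Fin m)) :
    ∀ {θ : Fin m → Y}, θ ∈ N.configs z m → (∃ k, θ k = 0) →
      JoinedIn (N.configs z m) θ (θ ∘ σ) := by
  induction σ using Equiv.Perm.swap_induction_on with
  | one => exact fun hθ _ => by simpa using JoinedIn.refl hθ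
  | swap_mul σ i j _ ih =>
    rintro θ hθ ⟨k, hk⟩
    have h1 := N.joinedIn_swap hθ hk i j
    exact h1.trans (ih h1.target_mem ⟨Equiv.swap i j k, by simpa using hk⟩)

theorem total_mem {s : Fin m → ι} {w : Fin m → ℝ} (hw : w ∈ conicReps (N.fit ∘ s) z) :
    total s w ∈ conicReps N.fit z :=
  ⟨fun _ => Finset.sum_nonneg fun j _ => hw.1 j, by simpa [sum_total] using hw.2⟩

/-- The configuration `θ` uses distinct neuron types, with weights `c`. -/
def IsPlacement (θ : Fin m → Y) (c : ι → ℝ) : Prop :=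
  ∃ s w, (∀ j, 0 ≤ w j) ∧ Set.InjOn s (support w) ∧ total s w = c ∧ N.params s w = θ

theorem injOn_of_isBasic {s : Fin m → ι} {w : Fin m → ℝ} (hw : IsBasic (N.fit ∘ s) z w) :
    Set.InjOn s (support w) := fun _ hi _ hj h =>
  hw.2.injOn hi hj (congrArg N.fit h)

theorem isBasic_total {s : Fin m → ι} {w : Fin m → ℝ} (hw : IsBasic (N.fit ∘ s) z w) :
    IsBasic N.fit z (total s w) :=
  ⟨N.total_mem hw.1, by
    rw [support_total hw.1.1]
    exact hw.2.image_of_comp s N.fit⟩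

/-- Any set of at most `m` neuron types fits into `m` slots. -/
theorem exists_slots [Nonempty ι] (U : Set ι) (hU : U.ncard ≤ m) :
    ∃ s : Fin m → ι, ∀ c ∈ conicReps N.fit z, support c ⊆ U →
      ∃ w ∈ conicReps (N.fit ∘ s) z, Set.InjOn s (support w) ∧ total s w = c := by
  classical
  obtain ⟨t⟩ : Nonempty (U ↪ Fin m) := by
    rw [Embedding.nonempty_iff_card_le, ← Nat.card_eq_fintype_card, Nat.card_coe_set_eq]
    simpa using hU
  -- The slot types depend on `U` only, not on `c`, so all representations supported in `U` share
  -- one piece.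
  refine ⟨extend t Subtype.val fun _ => Classical.arbitrary ι, fun c hc hcU => ?_⟩
  set s : Fin m → ι := extend t Subtype.val fun _ => Classical.arbitrary ι
  have hs : ∀ a : U, s (t a) = a := fun a => t.injective.extend_apply _ _ a
  let w : Fin m → ℝ := extend t (fun a => c a) 0
  have hwt : ∀ a : U, w (t a) = c a := fun a => t.injective.extend_apply _ _ a
  have hw0 : ∀ j, j ∉ Set.range t → w j = 0 := fun j hj =>
    extend_apply' _ _ _ fun ⟨a, ha⟩ => hj ⟨a, ha⟩
  have hwnn : ∀ j, 0 ≤ w j := fun j => by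
    by_cases hj : j ∈ Set.range t
    · obtain ⟨a, rfl⟩ := hj
      exact hwt a ▸ hc.1 a
    · exact (hw0 j hj).ge
  have hinj : Set.InjOn s (support w) := by
    intro i hi j hj hij
    obtain ⟨a, rfl⟩ : i ∈ Set.range t := by_contra fun h => hi (hw0 i h)
    obtain ⟨a', rfl⟩ : j ∈ Set.range t := by_contra fun h => hj (hw0 j h)
    rw [hs, hs] at hij
    rw [Subtype.ext hij]
  have htot : total s w = c := by
    funext a
    by_cases ha : c a = 0
    · rw [ha]
      by_contra h
      have : a ∈ s '' support w := by rwa [← support_total hwnn]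
      obtain ⟨j, hj, rfl⟩ := this
      obtain ⟨a, rfl⟩ : j ∈ Set.range t := by_contra fun h => hj (hw0 j h)
      rw [hs] at ha
      exact hj ((hwt a).trans ha)
    · have := total_apply hinj (j := t ⟨a, hcU ha⟩) (by rwa [hwt])
      rwa [hs, hwt] at this
  refine ⟨w, ⟨hwnn, ?_⟩, hinj, htot⟩
  rw [← hc.2, ← htot, sum_total]
  rfl

theorem IsPlacement.exists_perm {θ θ' : Fin m → Y} {c : ι → ℝ} (h : N.IsPlacement θ c)
    (h' : N.IsPlacement θ' c) : ∃ σ : Equiv.Perm (Fin m), θ' ∘ σ = θ := by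
  classical
  obtain ⟨s, w, hw, hs, htot, rfl⟩ := h
  obtain ⟨s', w', hw', hs', htot', rfl⟩ := h'
  have h1 : ∀ j : support w, ∃ i : support w', s' i = s j := by
    rintro ⟨j, hj⟩
    have : s j ∈ s' '' support w' := by
      rw [← support_total hw', htot', ← htot, support_total hw]
      exact ⟨j, hj, rfl⟩
    obtain ⟨i, hi, hij⟩ := this
    exact ⟨⟨i, hi⟩, hij⟩
  choose e he using h1
  have hbij : Bijective e := by
    constructor
    · intro i j hij
      have := he i
      rw [hij, he j] at this
      exact Subtype.ext (hs i.2 j.2 this.symm)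
    · rintro ⟨i, hi⟩
      have : s' i ∈ s '' support w := by
        rw [← support_total hw, htot, ← htot', support_total hw']
        exact ⟨i, hi, rfl⟩
      obtain ⟨j, hj, hij⟩ := this
      exact ⟨⟨j, hj⟩, Subtype.ext (hs' (e ⟨j, hj⟩).2 hi ((he _).trans hij))⟩
  -- Nonzero slots are matched by type. Any extension to a permutation works, since the remaining
  -- slots are zero on both sides.
  let E : {j // j ∈ support w} ≃ {j // j ∈ support w'} := Equiv.ofBijective e hbij
  refine ⟨E.extendSubtype, funext fun j => ?_⟩
  by_cases hj : j ∈ support w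
  · have h2 : E.extendSubtype j = e ⟨j, hj⟩ := E.extendSubtype_apply_of_mem j hj
    have h3 : w' (e ⟨j, hj⟩) = w j := by
      rw [← total_apply hs' (e ⟨j, hj⟩).2, he, htot', ← htot, total_apply hs hj]
    simp only [comp_apply, params, h2, h3, he]
  · have h2 : E.extendSubtype j ∉ support w' := E.extendSubtype_not_mem j hj
    rw [notMem_support] at hj h2
    simp [params, hj, h2, N.curve_zero]

theorem IsPlacement.exists_eq_zero {θ : Fin m → Y} {c : ι → ℝ} (h : N.IsPlacement θ c)
    (hc : (support c).ncard < m) : ∃ k, θ k = 0 := by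
  obtain ⟨s, w, hw, hs, rfl, rfl⟩ := h
  rw [ncard_support_total hw hs] at hc
  obtain ⟨k, hk⟩ : ∃ k, k ∉ support w := by
    by_contra! hcon
    rw [Set.eq_univ_of_forall hcon] at hc
    simp at hc
  exact ⟨k, by simp [params, notMem_support.1 hk, N.curve_zero]⟩

theorem IsPlacement.mem {θ : Fin m → Y} {c : ι → ℝ} (h : N.IsPlacement θ c)
    (hc : c ∈ conicReps N.fit z) : θ ∈ N.configs z m := by
  obtain ⟨s, w, hw, hs, rfl, rfl⟩ := h
  exact N.params_mem ⟨hw, by simpa [sum_total] using hc.2⟩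

theorem exists_isPlacement [Nonempty ι] {c : ι → ℝ} (hc : c ∈ conicReps N.fit z)
    (hcm : (support c).ncard ≤ m) : ∃ θ : Fin m → Y, N.IsPlacement θ c := by
  obtain ⟨s, hs⟩ := N.exists_slots (z := z) _ hcm
  obtain ⟨w, hw, hinj, htot⟩ := hs c hc subset_rfl
  exact ⟨_, s, w, hw.1, hinj, htot, rfl⟩

/-- Slots for the union of the supports give placements of `c` and `c'` in one convex piece. The
given placements differ from these by permutations, which are realised by paths because each leaves
a slot empty. -/
theorem IsPlacement.joinedIn_of_ncard_union_le [Nonempty ι] {θ θ' : Fin m → Y} {c c' : ι → ℝ}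
    (h : N.IsPlacement θ c) (h' : N.IsPlacement θ' c') (hc : c ∈ conicReps N.fit z)
    (hc' : c' ∈ conicReps N.fit z) (hcm : (support c).ncard < m) (hcm' : (support c').ncard < m)
    (hU : (support c ∪ support c').ncard ≤ m) : JoinedIn (N.configs z m) θ θ' := by
  obtain ⟨s, hs⟩ := N.exists_slots (z := z) _ hU
  obtain ⟨w, hw, hinj, htot⟩ := hs c hc Set.subset_union_left
  obtain ⟨w', hw', hinj', htot'⟩ := hs c' hc' Set.subset_union_right
  obtain ⟨σ, rfl⟩ := h.exists_perm N ⟨s, w, hw.1, hinj, htot, rfl⟩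
  obtain ⟨σ', rfl⟩ := h'.exists_perm N ⟨s, w', hw'.1, hinj', htot', rfl⟩
  have hp : N.IsPlacement (N.params s w) c := ⟨s, w, hw.1, hinj, htot, rfl⟩
  have hp' : N.IsPlacement (N.params s w') c' := ⟨s, w', hw'.1, hinj', htot', rfl⟩
  exact ((N.joinedIn_comp_perm_of_eq_zero σ (N.params_mem hw) (hp.exists_eq_zero N hcm)).symm.trans
    (N.joinedIn_params hw hw')).trans
    (N.joinedIn_comp_perm_of_eq_zero σ' (N.params_mem hw') (hp'.exists_eq_zero N hcm'))

/-- Carathéodory's theorem is applied inside the piece of `θ`, so a segment of weights leads to the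
basic representation. Its types are distinct, since an independent family has no repetitions. -/
theorem exists_joinedIn_isPlacement {θ : Fin m → Y} (hθ : θ ∈ N.configs z m) :
    ∃ c θ', IsBasic N.fit z c ∧ N.IsPlacement θ' c ∧ JoinedIn (N.configs z m) θ θ' := by
  obtain ⟨s, w, hw, rfl⟩ := N.exists_of_mem hθ
  obtain ⟨w', hw'⟩ := exists_isBasic ⟨w, hw⟩
  exact ⟨_, _, N.isBasic_total hw', ⟨s, w', hw'.1.1, N.injOn_of_isBasic hw', rfl, rfl⟩,
    N.joinedIn_params hw hw'.1⟩

/-- A simplex walk: among the finitely many basic representations reachable from `θ`, take one with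
least weight outside the support of `c'`. If it is not `c'`, a pivot reaches a better one, and the
two supports fit together into `m` slots. -/
theorem IsPlacement.exists_joinedIn_of_finrank_lt [Nonempty ι] [FiniteDimensional ℝ V]
    (hm : Module.finrank ℝ V < m) {θ : Fin m → Y} {c c' : ι → ℝ} (h : N.IsPlacement θ c)
    (hc : IsBasic N.fit z c) (hc' : IsBasic N.fit z c') :
    ∃ θ', N.IsPlacement θ' c' ∧ JoinedIn (N.configs z m) θ θ' := by
  classical
  let B : Set (ι → ℝ) := {e | IsBasic N.fit z e ∧ ∃ θ', N.IsPlacement θ' e ∧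
    JoinedIn (N.configs z m) θ θ'}
  let S : Finset ι := Finset.univ.filter fun a => c' a = 0
  obtain ⟨e, ⟨he, θ₁, hθ₁, hj⟩, hmin⟩ := Set.exists_min_image B (fun e => ∑ a ∈ S, e a)
    ((finite_isBasic N.fit z).subset fun e he => he.1) ⟨c, hc, θ, h, .refl (h.mem N hc.1)⟩
  by_cases hne : e = c'
  · exact ⟨θ₁, hne ▸ hθ₁, hj⟩
  obtain ⟨e', he', hlt, hcard⟩ := he.exists_pivot hc' hne (S := S) (by simp [S])
  obtain ⟨θ₂, hθ₂⟩ := N.exists_isPlacement he'.1 (he'.ncard_le.trans hm.le)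
  exact absurd (hmin e' ⟨he', θ₂, hθ₂, hj.trans (hθ₁.joinedIn_of_ncard_union_le N hθ₂ he.1 he'.1
    (he.ncard_le.trans_lt hm) (he'.ncard_le.trans_lt hm) (hcard.trans hm))⟩) hlt.not_ge

end NeuronModel


/-! ### The staircase for abstract neuron models. -/

namespace NeuronModel

open Function

variable {ι V Y : Type*} [Fintype ι] [NormedAddCommGroup V] [NormedSpace ℝ V]
  [TopologicalSpace Y] [Zero Y] (N : NeuronModel ι V Y) {z : V} {m p q : ℕ}

/-- The numbers of neuron types in basic representations of `z`. -/
def basicCards (z : V) : Set ℕ := (fun c => (support c).ncard) '' {c | IsBasic N.fit z c}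

theorem ncard_support_mem {s : Fin m → ι} {w : Fin m → ℝ} (hw : IsBasic (N.fit ∘ s) z w) :
    (support w).ncard ∈ N.basicCards z :=
  ⟨_, N.isBasic_total hw, ncard_support_total hw.1.1 (N.injOn_of_isBasic hw)⟩

theorem one_le_of_mem_basicCards (hz : z ≠ 0) {k : ℕ} (hk : k ∈ N.basicCards z) : 1 ≤ k := by
  obtain ⟨c, hc, rfl⟩ := hk
  rw [Nat.one_le_iff_ne_zero, Ne, Set.ncard_eq_zero, support_eq_empty_iff]
  rintro rfl
  exact hz (by simpa using hc.1.2.symm)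

theorem exists_ne_zero (hz : z ≠ 0) {θ : Fin m → Y} (hθ : θ ∈ N.configs z m) :
    ∃ i, θ i ≠ 0 := by
  obtain ⟨s, w, hw, rfl⟩ := N.exists_of_mem hθ
  by_contra! hcon
  refine hz ?_
  rw [← hw.2]
  exact Finset.sum_eq_zero fun j _ => by
    rw [(N.curve_eq_zero_iff _ (hw.1 j)).1 (hcon j), zero_smul]

theorem exists_joinedIn_ne_of_eq_zero (hz : z ≠ 0) {θ : Fin m → Y} (hθ : θ ∈ N.configs z m)
    (h0 : ∃ k, θ k = 0) : ∃ θ', θ' ≠ θ ∧ JoinedIn (N.configs z m) θ θ' := by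
  obtain ⟨k, hk⟩ := h0
  obtain ⟨i, hi⟩ := N.exists_ne_zero hz hθ
  refine ⟨_, fun h => hi ?_, N.joinedIn_swap_of_eq_zero hθ hk i⟩
  have := congrFun h k
  simpa [hk] using this

theorem conicReps_subsingleton {s : Fin m → ι} (hs : LinearIndependent ℝ (N.fit ∘ s)) :
    (conicReps (N.fit ∘ s) z).Subsingleton := fun _ hw _ hw' =>
  eq_of_linearIndepOn (linearIndepOn_univ_iff.2 hs) (by simp) (by simp) (hw.2.trans hw'.2.symm)

theorem configs_nonempty [Nonempty ι] (hp : p ∈ N.basicCards z) (hm : p ≤ m) :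
    (N.configs z m).Nonempty := by
  obtain ⟨c, hc, rfl⟩ := hp
  obtain ⟨θ, hθ⟩ := N.exists_isPlacement hc.1 hm
  exact ⟨θ, hθ.mem N hc.1⟩

/-- A basic representation in a piece must use all `p` slots, so the family of that piece is
independent and the piece is at most one point. -/
theorem configs_finite (hp : IsLeast (N.basicCards z) p) : (N.configs z p).Finite := by
  refine Set.finite_iUnion fun s => ?_
  rcases (conicReps (N.fit ∘ s) z).eq_empty_or_nonempty with h | h
  · simp [h]
  obtain ⟨w, hw⟩ := exists_isBasic h
  have h1 := hp.2 (N.ncard_support_mem hw)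
  have h2 : support w = Set.univ := by
    refine Set.eq_of_subset_of_ncard_le (Set.subset_univ _) ?_
    simpa using h1
  have h3 := hw.2
  rw [h2, linearIndepOn_univ_iff] at h3
  exact ((N.conicReps_subsingleton h3).finite).image _

theorem exists_eq_zero_of_basicCards [Nonempty ι] (hp : p ∈ N.basicCards z) (hm : p < m) :
    ∃ θ ∈ N.configs z m, ∃ k, θ k = 0 := by
  obtain ⟨c, hc, rfl⟩ := hp
  obtain ⟨θ, hθ⟩ := N.exists_isPlacement hc.1 hm.le
  exact ⟨θ, hθ.mem N hc.1, hθ.exists_eq_zero N hm⟩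

theorem exists_joinedIn_eq_zero (hq : IsGreatest (N.basicCards z) q) (hm : q < m)
    {θ : Fin m → Y} (hθ : θ ∈ N.configs z m) :
    ∃ θ', JoinedIn (N.configs z m) θ θ' ∧ ∃ k, θ' k = 0 := by
  obtain ⟨c, θ', hc, hθ', hj⟩ := N.exists_joinedIn_isPlacement hθ
  exact ⟨θ', hj, hθ'.exists_eq_zero N ((hq.2 ⟨c, hc, rfl⟩).trans_lt hm)⟩

theorem joinedIn_comp_perm (hq : IsGreatest (N.basicCards z) q) (hm : q < m)
    {θ : Fin m → Y} (hθ : θ ∈ N.configs z m) (σ : Equiv.Perm (Fin m)) :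
    JoinedIn (N.configs z m) θ (θ ∘ σ) := by
  obtain ⟨θ', hj, h0⟩ := N.exists_joinedIn_eq_zero hq hm hθ
  exact (hj.trans (N.joinedIn_comp_perm_of_eq_zero σ hj.target_mem h0)).trans
    (N.joinedIn_comp_of_joinedIn hj σ).symm

theorem exists_joinedIn_ne (hz : z ≠ 0) (hq : IsGreatest (N.basicCards z) q) (hm : q < m)
    {θ : Fin m → Y} (hθ : θ ∈ N.configs z m) :
    ∃ θ', θ' ≠ θ ∧ JoinedIn (N.configs z m) θ θ' := by
  by_cases h0 : ∃ k, θ k = 0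
  · exact N.exists_joinedIn_ne_of_eq_zero hz hθ h0
  · obtain ⟨θ', hj, h0'⟩ := N.exists_joinedIn_eq_zero hq hm hθ
    exact ⟨θ', fun h => h0 (h ▸ h0'), hj⟩

/-- A configuration whose `q` neurons have linearly independent outputs is isolated. -/
theorem exists_isolated [Nonempty ι] [T2Space Y] (hq : q ∈ N.basicCards z) :
    ∃ θ ∈ N.configs z q, (∃ U, IsOpen U ∧ θ ∈ U ∧ N.configs z q ∩ U ⊆ {θ}) ∧
      (2 ≤ q → ∃ θ' ∈ N.configs z q, θ' ≠ θ) := by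
  obtain ⟨c, hc, rfl⟩ := hq
  obtain ⟨s, hs⟩ := N.exists_slots (z := z) (support c) le_rfl
  obtain ⟨w, hw, hinj, htot⟩ := hs c hc.1 subset_rfl
  have h2 : support w = Set.univ := by
    refine Set.eq_of_subset_of_ncard_le (Set.subset_univ _) ?_
    rw [← ncard_support_total hw.1 hinj, htot]
    simp
  have hli : LinearIndependent ℝ (N.fit ∘ s) := by
    have := hc.2
    rw [← htot, support_total hw.1] at this
    have := this.comp_of_image hinj
    rwa [h2, linearIndepOn_univ_iff] at this
  have hw0 : ∀ j, w j ≠ 0 := fun j => by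
    have : j ∈ support w := h2 ▸ Set.mem_univ j
    exact this
  -- This independence is stated for the outputs, without reference to types, so it can be
  -- transferred to any other piece through the same point.
  have hout : LinearIndependent ℝ fun j => N.output (N.params s w j) := by
    have := hli.units_smul fun j => Units.mk0 (w j) (hw0 j)
    convert this using 2 with j
    exact N.output_curve _ _ (hw.1 j)
  refine ⟨N.params s w, N.params_mem hw, ?_, fun h2q => ?_⟩
  -- The finitely many pieces missing the point are compact, so their union is closed. A piece
  -- containing the point has independent fits, hence is that single point.
  · let F : Set (Fin (support c).ncard → Y) :=
      ⋃ s' ∈ {s' | N.params s w ∉ N.params s' '' conicReps (N.fit ∘ s') z},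
        N.params s' '' conicReps (N.fit ∘ s') z
    have hF : IsClosed F := (Set.toFinite _).isClosed_biUnion fun s' _ =>
      ((N.isCompact_conicReps s').image (N.continuous_params s')).isClosed
    refine ⟨Fᶜ, hF.isOpen_compl, ?_, ?_⟩
    · simp only [F, Set.mem_compl_iff, Set.mem_iUnion, not_exists]
      exact fun s' hs' => hs'
    · rintro θ ⟨hθ, hθF⟩
      obtain ⟨s', w', hw', rfl⟩ := N.exists_of_mem hθ
      have hmem : N.params s w ∈ N.params s' '' conicReps (N.fit ∘ s') z := by
        by_contra hcon
        exact hθF (Set.mem_biUnion hcon ⟨w', hw', rfl⟩)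
      obtain ⟨w'', hw'', heq⟩ := hmem
      have hout' : ∀ j, N.output (N.params s w j) = w'' j • N.fit (s' j) := fun j => by
        rw [← heq]
        exact N.output_curve _ _ (hw''.1 j)
      have hw''0 : ∀ j, w'' j ≠ 0 := fun j h => by
        have := hout' j
        rw [h, zero_smul] at this
        exact hout.ne_zero j this
      have hli' : LinearIndependent ℝ (N.fit ∘ s') := by
        have := hout.units_smul fun j => (Units.mk0 (w'' j) (hw''0 j))⁻¹
        convert this using 1
        funext j
        rw [Pi.smul_apply', hout' j, Units.smul_def, Units.val_inv_eq_inv_val, Units.val_mk0, smul_smul,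
          inv_mul_cancel₀ (hw''0 j), one_smul]
        rfl
      rw [Set.mem_singleton_iff, N.conicReps_subsingleton hli' hw' hw'', heq]
  · replace h2q : 2 ≤ (support c).ncard := h2q
    let i : Fin (support c).ncard := ⟨0, by omega⟩
    let j : Fin (support c).ncard := ⟨1, by omega⟩
    refine ⟨_, N.comp_perm_mem (N.params_mem hw) (Equiv.swap i j), fun h => ?_⟩
    have h1 : N.params s w j = N.params s w i := by simpa using congrFun h i
    have := hout.injective (a₁ := j) (a₂ := i) (by simp only [h1])
    simp [i, j] at this

theorem isPathConnected_configs [Nonempty ι] [FiniteDimensional ℝ V] (hz : z ≠ 0)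
    (hp : IsLeast (N.basicCards z) p) (hq : IsGreatest (N.basicCards z) q)
    (hm : min (p + q) (Module.finrank ℝ V + 1) ≤ m) : IsPathConnected (N.configs z m) := by
  obtain ⟨c, hc, hcp⟩ := hp.1
  have hcp' : (support c).ncard = p := hcp
  have hcq : (support c).ncard ≤ q := hq.2 ⟨c, hc, rfl⟩
  have hq1 : 1 ≤ p := N.one_le_of_mem_basicCards hz hp.1
  have hqn : q ≤ Module.finrank ℝ V := by
    obtain ⟨e, he, rfl⟩ := hq.1
    exact he.ncard_le
  -- Either `p ≥ 1`, from `z ≠ 0`, or `q ≤ finrank` gives the empty slot needed for permutations.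
  have hqm : q < m := by
    rcases min_le_iff.1 hm with h | h <;> omega
  obtain ⟨θ, hθ⟩ := N.exists_isPlacement hc.1 (hcq.trans hqm.le)
  refine ⟨θ, hθ.mem N hc.1, fun {θ'} hθ' => ?_⟩
  obtain ⟨e, θ₁, he, hθ₁, hj⟩ := N.exists_joinedIn_isPlacement hθ'
  have heq : (support e).ncard ≤ q := hq.2 ⟨e, he, rfl⟩
  refine JoinedIn.symm (hj.trans ?_)
  rcases min_le_iff.1 hm with h | h
  · refine hθ₁.joinedIn_of_ncard_union_le N hθ he.1 hc.1 (heq.trans_lt hqm) (hcq.trans_lt hqm) ?_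
    have := Set.ncard_union_le (support e) (support c)
    omega
  · obtain ⟨θ₂, hθ₂, hj₂⟩ := hθ₁.exists_joinedIn_of_finrank_lt N h he hc
    obtain ⟨σ, rfl⟩ := hθ₂.exists_perm N hθ
    exact hj₂.trans (N.joinedIn_comp_perm_of_eq_zero σ (hθ.mem N hc.1)
      (hθ.exists_eq_zero N (hcq.trans_lt hqm))).symm

end NeuronModel

/-! ### Isolated points and paths. -/

section Topology

variable {E : Type*} [TopologicalSpace E]

theorem IsPreconnected.eq_of_isolated [T1Space E] {F U : Set E} (hF : IsPreconnected F)
    (hU : IsOpen U) {x y : E} (hx : x ∈ F) (hxU : x ∈ U) (h : F ∩ U ⊆ {x}) (hy : y ∈ F) :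
    y = x := by
  by_contra hyx
  obtain ⟨z, hzF, hzU, hz⟩ := hF U {x}ᶜ hU isOpen_compl_singleton
    (fun z _ => by
      by_cases hz : z = x
      · exact Or.inl (hz ▸ hxU)
      · exact Or.inr hz) ⟨x, hx, hxU⟩ ⟨y, hy, hyx⟩
  exact hz (h ⟨hzF, hzU⟩)

theorem JoinedIn.eq_of_isolated [T1Space E] {F U : Set E} (hU : IsOpen U) {x y : E}
    (hxU : x ∈ U) (h : F ∩ U ⊆ {x}) (hj : JoinedIn F x y) : y = x := by
  have hsub : Set.range hj.somePath ⊆ F := by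
    rintro _ ⟨t, rfl⟩
    exact hj.somePath_mem t
  exact IsPreconnected.eq_of_isolated (isPreconnected_range hj.somePath.continuous) hU
    ⟨0, hj.somePath.source⟩ hxU ((Set.inter_subset_inter_left _ hsub).trans h)
    ⟨1, hj.somePath.target⟩

theorem JoinedIn.eq_of_finite [T1Space E] {F : Set E} (hF : F.Finite) {x y : E}
    (h : JoinedIn F x y) : y = x :=
  JoinedIn.eq_of_isolated (hF.subset Set.sdiff_subset : (F \ {x}).Finite).isClosed.isOpen_compl
    (by simp) (fun z ⟨hz, hz'⟩ => by_contra fun hne => hz' ⟨hz, hne⟩) h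

end Topology


/-! ### The optimal set of a cone-constrained group LASSO. -/

/-- The cone-constrained group LASSO `min loss (∑ k, design k (q k)) + β ∑ k, ‖q k‖` over
`q k ∈ cone k`. -/
structure ConeLasso (K E V : Type*) [Fintype K] [NormedAddCommGroup E] [InnerProductSpace ℝ E]
    [AddCommGroup V] [Module ℝ V] where
  design : K → E →ₗ[ℝ] V
  cone : K → Set E
  zero_mem : ∀ k, 0 ∈ cone k
  add_mem : ∀ k x y, x ∈ cone k → y ∈ cone k → x + y ∈ cone k
  smul_mem : ∀ k x (t : ℝ), 0 ≤ t → x ∈ cone k → t • x ∈ cone k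
  loss : V → ℝ
  strictConvexOn_loss : StrictConvexOn ℝ Set.univ loss
  β : ℝ
  β_pos : 0 < β

namespace ConeLasso

variable {K E V : Type*} [Fintype K] [NormedAddCommGroup E] [InnerProductSpace ℝ E]
    [AddCommGroup V] [Module ℝ V] (P : ConeLasso K E V)

def fit : (K → E) →ₗ[ℝ] V := ∑ k, (P.design k).comp (LinearMap.proj k)

theorem fit_apply (q : K → E) : P.fit q = ∑ k, P.design k (q k) := by
  simp [fit]

def objective (q : K → E) : ℝ := P.loss (P.fit q) + P.β * ∑ k, ‖q k‖

def optimal : Set (K → E) :=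
  {q | (∀ k, q k ∈ P.cone k) ∧ ∀ q', (∀ k, q' k ∈ P.cone k) → P.objective q ≤ P.objective q'}

variable {P}

theorem mem_optimal_of_le {p q : K → E} (hp : p ∈ P.optimal) (hq : ∀ k, q k ∈ P.cone k)
    (hfit : P.fit q = P.fit p) (hnorm : ∑ k, ‖q k‖ ≤ ∑ k, ‖p k‖) : q ∈ P.optimal := by
  refine ⟨hq, fun q' hq' => le_trans ?_ (hp.2 q' hq')⟩
  rw [objective, objective, hfit]
  have := mul_le_mul_of_nonneg_left hnorm P.β_pos.le
  linarith

theorem sum_norm_combo_le (p q : K → E) {s t : ℝ} (hs : 0 ≤ s) (ht : 0 ≤ t) :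
    ∑ k, ‖(s • p + t • q) k‖ ≤ s * ∑ k, ‖p k‖ + t * ∑ k, ‖q k‖ := by
  rw [Finset.mul_sum, Finset.mul_sum, ← Finset.sum_add_distrib]
  refine Finset.sum_le_sum fun k _ => (norm_add_le _ _).trans_eq ?_
  simp [norm_smul, abs_of_nonneg hs, abs_of_nonneg ht]

theorem combo_mem {p q : K → E} (hp : p ∈ P.optimal) (hq : q ∈ P.optimal) {s t : ℝ}
    (hs : 0 ≤ s) (ht : 0 ≤ t) (k : K) : (s • p + t • q) k ∈ P.cone k :=
  P.add_mem _ _ _ (P.smul_mem _ _ _ hs (hp.1 k)) (P.smul_mem _ _ _ ht (hq.1 k))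

theorem objective_eq {p q : K → E} (hp : p ∈ P.optimal) (hq : q ∈ P.optimal) :
    P.objective p = P.objective q :=
  le_antisymm (hp.2 q hq.1) (hq.2 p hp.1)

/-- Otherwise the midpoint would be strictly better, by strict convexity of the loss. -/
theorem fit_eq {p q : K → E} (hp : p ∈ P.optimal) (hq : q ∈ P.optimal) :
    P.fit p = P.fit q := by
  by_contra hne
  have h1 := P.strictConvexOn_loss.2 (Set.mem_univ _) (Set.mem_univ _) hne
    (half_pos one_pos) (half_pos one_pos) (add_halves (1 : ℝ))
  have h2 := hp.2 _ (combo_mem hp hq (half_pos one_pos).le (half_pos one_pos).le)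
  have h3 := mul_le_mul_of_nonneg_left (sum_norm_combo_le p q (half_pos one_pos).le
    (half_pos one_pos).le) P.β_pos.le
  have h4 := objective_eq hp hq
  simp only [objective, map_add, map_smul, smul_eq_mul] at h1 h2 h4
  linarith

theorem sum_norm_eq {p q : K → E} (hp : p ∈ P.optimal) (hq : q ∈ P.optimal) :
    ∑ k, ‖p k‖ = ∑ k, ‖q k‖ := by
  have h := objective_eq hp hq
  rw [objective, objective, fit_eq hp hq] at h
  exact mul_left_cancel₀ P.β_pos.ne' (add_left_cancel h)

/-- The midpoint has the same fit, so optimality forces equality in the triangle inequality in every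
block. -/
theorem sameRay {p q : K → E} (hp : p ∈ P.optimal) (hq : q ∈ P.optimal) (k : K) :
    SameRay ℝ (p k) (q k) := by
  have hle : ∑ k, ‖p k + q k‖ ≤ ∑ k, (‖p k‖ + ‖q k‖) :=
    Finset.sum_le_sum fun k _ => norm_add_le _ _
  have hge : ∑ k, (‖p k‖ + ‖q k‖) ≤ ∑ k, ‖p k + q k‖ := by
    have h2 := hp.2 _ (combo_mem hp hq (half_pos one_pos).le (half_pos one_pos).le)
    have h3 : P.fit ((1 / 2 : ℝ) • p + (1 / 2 : ℝ) • q) = P.fit p := by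
      rw [map_add, map_smul, map_smul, ← fit_eq hp hq, ← add_smul, add_halves, one_smul]
    have h4 : ∑ k, ‖((1 / 2 : ℝ) • p + (1 / 2 : ℝ) • q) k‖ = 1 / 2 * ∑ k, ‖p k + q k‖ := by
      rw [Finset.mul_sum]
      refine Finset.sum_congr rfl fun k _ => ?_
      rw [Pi.add_apply, Pi.smul_apply, Pi.smul_apply, ← smul_add, norm_smul]
      norm_num
    rw [objective, objective, h3, h4] at h2
    have h5 := le_of_mul_le_mul_left (le_of_add_le_add_left h2) P.β_pos
    rw [Finset.sum_add_distrib, ← sum_norm_eq hp hq]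
    linarith
  rw [sameRay_iff_norm_add]
  exact (Finset.sum_eq_sum_iff_of_le fun k _ => norm_add_le _ _).1 (hle.antisymm hge) k
    (Finset.mem_univ k)

theorem convex_optimal : Convex ℝ P.optimal := by
  intro p hp q hq s t hs ht hst
  refine mem_optimal_of_le hp (combo_mem hp hq hs ht) ?_
    ((sum_norm_combo_le p q hs ht).trans_eq ?_)
  · rw [map_add, map_smul, map_smul, ← fit_eq hp hq, ← add_smul, hst, one_smul]
  · rw [← sum_norm_eq hp hq, ← add_mul, hst, one_mul]

variable (P)

/-- A block is active if some optimal solution uses it. -/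
def Active (k : K) : Prop := ∃ q ∈ P.optimal, q k ≠ 0

open Classical in
/-- The unit direction common to all optimal solutions in an active block. -/
def dir (k : K) : E := if h : P.Active k then ‖h.choose k‖⁻¹ • h.choose k else 0

/-- The types of active blocks. -/
abbrev Atom : Type _ := {k // P.Active k}

open Classical in
instance : Fintype P.Atom := Subtype.fintype _

def atomFit (a : P.Atom) : V := P.design a (P.dir a)

open Classical in
/-- The variables with norms `c` in the active directions. -/
def ofWeights (c : P.Atom → ℝ) (k : K) : E := if h : P.Active k then c ⟨k, h⟩ • P.dir k else 0

variable {P}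

theorem norm_dir (a : P.Atom) : ‖P.dir a‖ = 1 := by
  rw [dir, dif_pos a.2, norm_smul, norm_inv, norm_norm,
    inv_mul_cancel₀ (norm_ne_zero_iff.2 a.2.choose_spec.2)]

theorem dir_ne_zero (a : P.Atom) : P.dir a ≠ 0 :=
  norm_ne_zero_iff.1 (by rw [norm_dir]; exact one_ne_zero)

theorem dir_mem (k : K) : P.dir k ∈ P.cone k := by
  rw [dir]
  split_ifs with h
  · exact P.smul_mem _ _ _ (by positivity) (h.choose_spec.1.1 k)
  · exact P.zero_mem k

theorem eq_zero_of_not_active {q : K → E} (hq : q ∈ P.optimal) {k : K} (hk : ¬ P.Active k) :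
    q k = 0 :=
  by_contra fun h => hk ⟨q, hq, h⟩

theorem eq_smul_dir {q : K → E} (hq : q ∈ P.optimal) (k : K) : q k = ‖q k‖ • P.dir k := by
  by_cases hk : P.Active k
  · rw [dir, dif_pos hk, smul_comm, ← (sameRay hk.choose_spec.1 hq k).norm_smul_eq, smul_smul,
      inv_mul_cancel₀ (norm_ne_zero_iff.2 hk.choose_spec.2), one_smul]
  · simp [eq_zero_of_not_active hq hk]

theorem ofWeights_apply (c : P.Atom → ℝ) (a : P.Atom) : P.ofWeights c a = c a • P.dir a := by
  rw [ofWeights, dif_pos a.2]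

theorem ofWeights_of_not_active (c : P.Atom → ℝ) {k : K} (hk : ¬ P.Active k) :
    P.ofWeights c k = 0 := by
  rw [ofWeights, dif_neg hk]

theorem sum_atom {M : Type*} [AddCommMonoid M] (g : K → M) (hg : ∀ k, ¬ P.Active k → g k = 0) :
    ∑ a : P.Atom, g a = ∑ k, g k :=
  Fintype.sum_of_injective Subtype.val Subtype.val_injective _ _
    (fun k hk => hg k fun h => hk ⟨⟨k, h⟩, rfl⟩) fun _ => rfl

theorem fit_ofWeights (c : P.Atom → ℝ) : P.fit (P.ofWeights c) = ∑ a, c a • P.atomFit a := by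
  rw [fit_apply, ← sum_atom (P := P)]
  · exact Finset.sum_congr rfl fun a _ => by rw [ofWeights_apply, map_smul, atomFit]
  · intro k hk
    rw [ofWeights_of_not_active c hk, map_zero]

theorem norm_ofWeights {c : P.Atom → ℝ} (hc : ∀ a, 0 ≤ c a) (a : P.Atom) :
    ‖P.ofWeights c a‖ = c a := by
  rw [ofWeights_apply, norm_smul, norm_dir, mul_one, Real.norm_of_nonneg (hc a)]

theorem sum_norm_ofWeights {c : P.Atom → ℝ} (hc : ∀ a, 0 ≤ c a) :
    ∑ k, ‖P.ofWeights c k‖ = ∑ a, c a := by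
  rw [← sum_atom (P := P)]
  · exact Finset.sum_congr rfl fun a _ => norm_ofWeights hc a
  · intro k hk
    rw [ofWeights_of_not_active c hk, norm_zero]

theorem ofWeights_mem_cone {c : P.Atom → ℝ} (hc : ∀ a, 0 ≤ c a) (k : K) :
    P.ofWeights c k ∈ P.cone k := by
  rw [ofWeights]
  split_ifs with h
  · exact P.smul_mem _ _ _ (hc _) (dir_mem k)
  · exact P.zero_mem k

theorem ofWeights_norm {q : K → E} (hq : q ∈ P.optimal) :
    P.ofWeights (fun a => ‖q a‖) = q := by
  funext k
  by_cases hk : P.Active k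
  · exact (ofWeights_apply _ ⟨k, hk⟩).trans (eq_smul_dir hq k).symm
  · rw [ofWeights_of_not_active _ hk, eq_zero_of_not_active hq hk]

theorem norm_mem_conicReps {p q : K → E} (hp : p ∈ P.optimal) (hq : q ∈ P.optimal) :
    (fun a : P.Atom => ‖q a‖) ∈ conicReps P.atomFit (P.fit p) :=
  ⟨fun _ => norm_nonneg _, by rw [← fit_ofWeights, ofWeights_norm hq, fit_eq hp hq]⟩

/-- Averaging, over the atoms, an optimal solution active at each: no cancellation occurs, since
each block stays on its ray. -/
theorem exists_pos (hne : P.optimal.Nonempty) :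
    ∃ q ∈ P.optimal, ∀ a : P.Atom, 0 < ‖q a‖ := by
  rcases isEmpty_or_nonempty P.Atom with h | h
  · exact ⟨_, hne.some_mem, fun a => h.elim a⟩
  choose Q hQ hQ0 using fun a : P.Atom => a.2
  let N : ℝ := Fintype.card P.Atom
  have hN : 0 < N := Nat.cast_pos.2 Fintype.card_pos
  have hmem : ∑ a, N⁻¹ • Q a ∈ P.optimal :=
    convex_optimal.sum_mem (fun _ _ => by positivity)
      (by simp [N, Fintype.card_ne_zero]) fun a _ => hQ a
  refine ⟨_, hmem, fun a => ?_⟩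
  have h1 : (∑ a', N⁻¹ • Q a') a = (∑ a', N⁻¹ * ‖Q a' a‖) • P.dir a := by
    rw [Finset.sum_apply, Finset.sum_smul]
    refine Finset.sum_congr rfl fun a' _ => ?_
    rw [Pi.smul_apply, mul_smul, ← eq_smul_dir (hQ a')]
  have h2 : 0 < ∑ a', N⁻¹ * ‖Q a' a‖ :=
    Finset.sum_pos' (fun _ _ => by positivity)
      ⟨a, Finset.mem_univ _, mul_pos (by positivity) (norm_pos_iff.2 (hQ0 a))⟩
  rw [h1]
  exact norm_pos_iff.2 (smul_ne_zero h2.ne' (dir_ne_zero a))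

/-- Starting from an optimal solution with all weights positive, small moves along `r` and `-r` stay
feasible and keep the fit. Neither may lower the total norm, so it is stationary. -/
theorem sum_eq_zero (hne : P.optimal.Nonempty) {r : P.Atom → ℝ}
    (hr : ∑ a, r a • P.atomFit a = 0) : ∑ a, r a = 0 := by
  obtain ⟨q, hq, hpos⟩ := exists_pos hne
  -- Small enough that `ε * |r a| ≤ ‖q a‖` for every atom at once; the `+ 1` keeps the inverse
  -- positive.
  let ε : ℝ := (∑ a : P.Atom, |r a| / ‖q a‖ + 1)⁻¹
  have hsum : 0 ≤ ∑ a : P.Atom, |r a| / ‖q a‖ :=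
    Finset.sum_nonneg fun a _ => div_nonneg (abs_nonneg _) (norm_nonneg _)
  have hε : 0 < ε := inv_pos.2 (by linarith)
  have hle : ∀ a, ε * |r a| ≤ ‖q a‖ := fun a => by
    rw [inv_mul_le_iff₀ (by linarith), ← div_le_iff₀ (hpos a)]
    have := Finset.single_le_sum (f := fun a : P.Atom => |r a| / ‖q a‖)
      (fun a _ => div_nonneg (abs_nonneg _) (norm_nonneg _)) (Finset.mem_univ a)
    linarith
  have key : ∀ t : ℝ, |t| = ε → 0 ≤ t * ∑ a, r a := by
    intro t ht
    have hnn : ∀ a : P.Atom, 0 ≤ ‖q a‖ + t * r a := fun a => by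
      have h1 := hle a
      rw [← ht, ← abs_mul] at h1
      have := neg_abs_le (t * r a)
      linarith
    have hfit : P.fit (P.ofWeights fun a => ‖q a‖ + t * r a) = P.fit q := by
      rw [fit_ofWeights, ← (norm_mem_conicReps hq hq).2]
      simp only [add_smul, mul_smul, Finset.sum_add_distrib, ← Finset.smul_sum, hr, smul_zero,
        add_zero]
    have h2 := hq.2 _ (ofWeights_mem_cone hnn)
    rw [objective, objective, hfit] at h2
    have h3 := le_of_mul_le_mul_left (le_of_add_le_add_left h2) P.β_pos
    rw [sum_norm_ofWeights hnn, Finset.sum_add_distrib, ← Finset.mul_sum,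
      sum_atom (fun k => ‖q k‖) fun k hk => by rw [eq_zero_of_not_active hq hk, norm_zero]] at h3
    linarith
  have h1 := key ε (abs_of_pos hε)
  have h2 := key (-ε) (by rw [abs_neg, abs_of_pos hε])
  have h3 : ε * ∑ a, r a = 0 := by linarith
  exact (mul_eq_zero.1 h3).resolve_left hε.ne'

theorem sum_weights_eq {p : K → E} (hp : p ∈ P.optimal) {c : P.Atom → ℝ}
    (hc : c ∈ conicReps P.atomFit (P.fit p)) : ∑ a, c a = ∑ k, ‖p k‖ := by
  have h := sum_eq_zero ⟨p, hp⟩ (r := fun a => c a - ‖p a‖) (by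
    simp [sub_smul, hc.2, (norm_mem_conicReps hp hp).2])
  rw [Finset.sum_sub_distrib, sub_eq_zero] at h
  rw [h, sum_atom (fun k => ‖p k‖) fun k hk => by rw [eq_zero_of_not_active hp hk, norm_zero]]

theorem ofWeights_mem {p : K → E} (hp : p ∈ P.optimal) {c : P.Atom → ℝ}
    (hc : c ∈ conicReps P.atomFit (P.fit p)) : P.ofWeights c ∈ P.optimal :=
  mem_optimal_of_le hp (ofWeights_mem_cone hc.1) (by rw [fit_ofWeights, hc.2])
    (by rw [sum_norm_ofWeights hc.1, sum_weights_eq hp hc])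

end ConeLasso


/-! ### The convex reformulation as a group LASSO, and its neurons. -/

section Link

variable {n d : ℕ} {X : Matrix (Fin n) (Fin d) ℝ}

/-- The sign of a block: `u_i` enters the fit positively and `v_i` negatively. -/
def blockSign : patterns X ⊕ patterns X → ℝ := Sum.elim (fun _ => 1) (fun _ => -1)

def blockPattern : patterns X ⊕ patterns X → patterns X := Sum.elim id id

theorem abs_blockSign (k : patterns X ⊕ patterns X) : |blockSign k| = 1 := by
  rcases k with k | k <;> simp [blockSign]

theorem blockSign_mul_self (k : patterns X ⊕ patterns X) : blockSign k * blockSign k = 1 := by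
  rcases k with k | k <;> simp [blockSign]

theorem relu_smul {t : ℝ} (ht : 0 ≤ t) (v : Fin n → ℝ) : relu (t • v) = t • relu v := by
  funext k
  simp only [relu, Pi.smul_apply, smul_eq_mul]
  rw [mul_max_of_nonneg _ _ ht, mul_zero]

theorem mem_patternCone_iff {h u : EuclideanSpace ℝ (Fin d)} :
    u ∈ patternCone X (arrangement X h) ↔
      ∀ k, 0 ≤ (2 * (if 0 ≤ (X *ᵥ h.ofLp) k then (1 : ℝ) else 0) - 1) * (X *ᵥ u.ofLp) k := by
  rw [patternCone, Set.mem_ofPred_eq, ← Matrix.mulVec_mulVec, Matrix.sub_mulVec, Matrix.smul_mulVec,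
    arrangement, Matrix.one_mulVec, Pi.le_def]
  refine forall_congr' fun k => ?_
  simp only [Pi.zero_apply, Pi.sub_apply, Pi.smul_apply, smul_eq_mul, Matrix.mulVec_diagonal]
  ring_nf

theorem relu_mulVec_of_mem_patternCone {D : Matrix (Fin n) (Fin n) ℝ} (hD : D ∈ patterns X)
    {u : EuclideanSpace ℝ (Fin d)} (hu : u ∈ patternCone X D) :
    relu (X *ᵥ u.ofLp) = (D * X) *ᵥ u.ofLp := by
  obtain ⟨h, rfl⟩ := hD
  rw [mem_patternCone_iff] at hu
  funext k
  rw [← Matrix.mulVec_mulVec, arrangement, Matrix.mulVec_diagonal, relu]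
  have := hu k
  split_ifs at this ⊢
  · rw [max_eq_left (by linarith), one_mul]
  · rw [max_eq_right (by linarith), zero_mul]

theorem mem_patternCone_arrangement (w : EuclideanSpace ℝ (Fin d)) :
    w ∈ patternCone X (arrangement X w) := by
  rw [mem_patternCone_iff]
  intro k
  split_ifs with h
  · linarith
  · linarith

variable (X) in
/-- The convex reformulation as a group LASSO in the blocks. -/
def lasso {ℓ : (Fin n → ℝ) → ℝ} (hℓ : StrictConvexOn ℝ Set.univ ℓ) {β : ℝ} (hβ : 0 < β) :
    ConeLasso (patterns X ⊕ patterns X) (EuclideanSpace ℝ (Fin d)) (Fin n → ℝ) where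
  design k := blockSign k • ((blockPattern k).1 * X).mulVecLin ∘ₗ
    (WithLp.linearEquiv 2 ℝ (Fin d → ℝ)).toLinearMap
  cone k := patternCone X (blockPattern k).1
  zero_mem k := by simp [patternCone]
  add_mem k x y hx hy := by
    simp only [patternCone, Set.mem_ofPred_eq, WithLp.ofLp_add, Matrix.mulVec_add] at *
    exact add_nonneg hx hy
  smul_mem k x t ht hx := by
    simp only [patternCone, Set.mem_ofPred_eq, WithLp.ofLp_smul, Matrix.mulVec_smul] at *
    exact smul_nonneg ht hx
  loss := ℓ
  strictConvexOn_loss := hℓ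
  β := β
  β_pos := hβ

variable {ℓ : (Fin n → ℝ) → ℝ} {hℓ : StrictConvexOn ℝ Set.univ ℓ} {β : ℝ} {hβ : 0 < β}

theorem lasso_design (k : patterns X ⊕ patterns X) (u : EuclideanSpace ℝ (Fin d)) :
    (lasso X hℓ hβ).design k u = blockSign k • (((blockPattern k).1 * X) *ᵥ u.ofLp) := rfl

theorem lasso_design_of_mem {k : patterns X ⊕ patterns X} {u : EuclideanSpace ℝ (Fin d)}
    (hu : u ∈ (lasso X hℓ hβ).cone k) :
    (lasso X hℓ hβ).design k u = blockSign k • relu (X *ᵥ u.ofLp) := by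
  rw [lasso_design, relu_mulVec_of_mem_patternCone (blockPattern k).2 hu]

theorem lasso_objective_block {L : (Fin n → ℝ) → (Fin n → ℝ) → ℝ} {y : Fin n → ℝ}
    {hL : StrictConvexOn ℝ Set.univ fun z => L z y} (p : ConvexVars X) :
    (lasso X hL hβ).objective (block p) = convexObjective L X y β p := by
  have h : (lasso X hL hβ).fit (block p) =
      ∑ i, (i.1 * X) *ᵥ ((p i).1 - (p i).2).ofLp := by
    rw [ConeLasso.fit_apply, Fintype.sum_sum_type, ← Finset.sum_add_distrib]
    refine Finset.sum_congr rfl fun i _ => ?_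
    simp [lasso_design, blockSign, blockPattern, block, sub_eq_add_neg,
      Matrix.mulVec_add, Matrix.mulVec_neg]
  rw [ConeLasso.objective, convexObjective, h, Fintype.sum_sum_type, ← Finset.sum_add_distrib]
  rfl

theorem isFeasible_iff_block (p : ConvexVars X) :
    IsFeasible X p ↔ ∀ k, block p k ∈ (lasso X hℓ hβ).cone k :=
  ⟨fun h k => by
    rcases k with k | k
    exacts [(h k).1, (h k).2], fun h i => ⟨h (.inl i), h (.inr i)⟩⟩

/-- The convex variables with given blocks. -/
def ofBlocks (q : patterns X ⊕ patterns X → EuclideanSpace ℝ (Fin d)) : ConvexVars X :=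
  fun i => (q (.inl i), q (.inr i))

theorem block_ofBlocks (q : patterns X ⊕ patterns X → EuclideanSpace ℝ (Fin d)) :
    block (ofBlocks q) = q := by
  funext k
  rcases k with k | k <;> rfl

theorem mem_convexOptimal_iff {L : (Fin n → ℝ) → (Fin n → ℝ) → ℝ} {y : Fin n → ℝ}
    {hL : StrictConvexOn ℝ Set.univ fun z => L z y} {p : ConvexVars X} :
    p ∈ convexOptimal L X y β ↔ block p ∈ (lasso X hL hβ).optimal := by
  refine and_congr (isFeasible_iff_block p) ⟨fun h q hq => ?_, fun h q hq => ?_⟩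
  · rw [← block_ofBlocks q, lasso_objective_block, lasso_objective_block]
    refine h _ ((isFeasible_iff_block (hℓ := hL) (hβ := hβ) _).2 ?_)
    rwa [block_ofBlocks]
  · rw [← lasso_objective_block (hL := hL) (hβ := hβ), ← lasso_objective_block (hL := hL) (hβ := hβ)]
    exact h _ ((isFeasible_iff_block q).1 hq)

theorem card_eq_ncard (p : ConvexVars X) : card p = {k | block p k ≠ 0}.ncard := by
  classical
  have : {k | block p k ≠ 0} = ((Finset.univ.filter fun k => block p k ≠ 0 : Finset _) : Set _) := by
    simp
  rw [this, Set.ncard_coe_finset, Finset.card_filter, Fintype.sum_sum_type,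
    ← Finset.sum_add_distrib]
  refine Finset.sum_congr rfl fun i _ => ?_
  simp only [block, Sum.elim_inl, Sum.elim_inr]
  congr

/-- Each nonzero block has as its fit a nonzero multiple, sign times norm, of the fit of its atom.
-/
theorem linearIndependent_blockFit_iff {p : ConvexVars X}
    (hp : block p ∈ (lasso X hℓ hβ).optimal) :
    LinearIndependent ℝ (fun k : {k : patterns X ⊕ patterns X // block p k ≠ 0} => blockFit p k) ↔
      LinearIndepOn ℝ (lasso X hℓ hβ).atomFit (Function.support fun a => ‖block p a‖) := by
  let e : (Function.support fun a : (lasso X hℓ hβ).Atom => ‖block p a‖) ≃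
      {k : patterns X ⊕ patterns X // block p k ≠ 0} :=
    { toFun := fun a => ⟨a.1, norm_ne_zero_iff.1 a.2⟩
      invFun := fun k => ⟨⟨k, ⟨_, hp, k.2⟩⟩, norm_ne_zero_iff.2 k.2⟩
      left_inv := fun _ => rfl
      right_inv := fun _ => rfl }
  have hunit : ∀ a : (Function.support fun a : (lasso X hℓ hβ).Atom => ‖block p a‖),
      blockSign a.1.1 * ‖block p a.1‖ ≠ 0 := fun a =>
    mul_ne_zero (fun h => by simpa [h] using abs_blockSign a.1.1) a.2
  rw [← linearIndependent_equiv e, LinearIndepOn, ← LinearIndependent.units_smul_iff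
    (fun a : (Function.support fun a : (lasso X hℓ hβ).Atom => ‖block p a‖) =>
      (lasso X hℓ hβ).atomFit a) fun a => Units.mk0 _ (hunit a)]
  suffices h : ((fun k : {k : patterns X ⊕ patterns X // block p k ≠ 0} => blockFit p k) ∘ e) =
      (fun a => Units.mk0 _ (hunit a)) •
      fun a : (Function.support fun a : (lasso X hℓ hβ).Atom => ‖block p a‖) =>
        (lasso X hℓ hβ).atomFit a by rw [h]
  funext a
  have h1 : blockFit p a.1 = blockSign a.1.1 • (lasso X hℓ hβ).design a.1.1 (block p a.1) := by
    rw [lasso_design, smul_smul, blockSign_mul_self, one_smul]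
    rcases a.1.1 with k | k <;> rfl
  rw [Pi.smul_apply', Units.smul_def, Units.val_mk0]
  change blockFit p a.1 = _
  conv_lhs => rw [h1, ConeLasso.eq_smul_dir hp, map_smul, smul_smul]
  rfl

theorem sqrt_smul_norm_sq {u : EuclideanSpace ℝ (Fin d)} (hu : ‖u‖ = 1) {w : ℝ} (hw : 0 ≤ w) :
    ‖√w • u‖ ^ 2 = w := by
  rw [norm_smul, hu, mul_one, Real.norm_of_nonneg (Real.sqrt_nonneg w), Real.sq_sqrt hw]

/-- The neurons of optimal networks: balanced, and aligned with the directions of the convex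
reformulation. -/
def neuronModel (hne : (lasso X hℓ hβ).optimal.Nonempty) :
    NeuronModel (lasso X hℓ hβ).Atom (Fin n → ℝ) (EuclideanSpace ℝ (Fin d) × ℝ) where
  fit := (lasso X hℓ hβ).atomFit
  -- Balance makes both factors of size `√w`, so their product carries weight `w`.
  curve a w := (√w • (lasso X hℓ hβ).dir a, blockSign a.1 * √w)
  output x := x.2 • relu (X *ᵥ x.1.ofLp)
  continuous_curve a := by fun_prop
  curve_zero a := by simp
  output_curve a w hw := by
    simp only [WithLp.ofLp_smul, Matrix.mulVec_smul]
    rw [relu_smul (Real.sqrt_nonneg w), smul_smul, mul_assoc, Real.mul_self_sqrt hw,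
      ConeLasso.atomFit, lasso_design_of_mem (ConeLasso.dir_mem _), smul_smul, mul_comm]
  sum_eq_zero r hr := ConeLasso.sum_eq_zero hne hr

/-- Block norms and `ofWeights` translate between optimal solutions and conic representations of the
common fit, preserving supports and independence. -/
theorem card_image_irreducibleOptimal {L : (Fin n → ℝ) → (Fin n → ℝ) → ℝ} {y : Fin n → ℝ}
    {hL : StrictConvexOn ℝ Set.univ fun z => L z y}
    {q : patterns X ⊕ patterns X → EuclideanSpace ℝ (Fin d)} (hq : q ∈ (lasso X hL hβ).optimal) :
    card '' irreducibleOptimal L X y β =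
      (neuronModel (Set.nonempty_of_mem hq)).basicCards ((lasso X hL hβ).fit q) := by
  have hcard : ∀ p : ConvexVars X, block p ∈ (lasso X hL hβ).optimal →
      (Function.support fun a : (lasso X hL hβ).Atom => ‖block p a‖).ncard = card p := by
    intro p hp
    rw [card_eq_ncard, ← Set.ncard_image_of_injective _ Subtype.val_injective]
    congr 1
    ext k
    simp only [Set.mem_image, Function.mem_support, norm_ne_zero_iff, Set.mem_ofPred_eq]
    exact ⟨fun ⟨a, ha, h⟩ => h ▸ ha, fun h => ⟨⟨k, _, hp, h⟩, h, rfl⟩⟩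
  ext m
  constructor
  · rintro ⟨p, ⟨hp, hli⟩, rfl⟩
    rw [mem_convexOptimal_iff (hL := hL) (hβ := hβ)] at hp
    exact ⟨_, ⟨ConeLasso.norm_mem_conicReps hq hp, (linearIndependent_blockFit_iff hp).1 hli⟩,
      hcard p hp⟩
  · rintro ⟨c, ⟨hc, hli⟩, rfl⟩
    have hmem := ConeLasso.ofWeights_mem hq hc
    rw [← block_ofBlocks ((lasso X hL hβ).ofWeights c)] at hmem
    have hnorm : (fun a : (lasso X hL hβ).Atom =>
        ‖block (ofBlocks ((lasso X hL hβ).ofWeights c)) a‖) = c := by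
      rw [block_ofBlocks]
      exact funext fun a => ConeLasso.norm_ofWeights hc.1 a
    refine ⟨_, ⟨mem_convexOptimal_iff.2 hmem, (linearIndependent_blockFit_iff hmem).2 ?_⟩, ?_⟩
    · rwa [hnorm]
    · rw [← hcard _ hmem, hnorm]

/-! ### Merging the neurons of a network into blocks. -/

section Lift

variable {m : ℕ} (θ : Params d m)

variable (X) in
/-- The block to which a neuron belongs. -/
def neuronBlock (x : EuclideanSpace ℝ (Fin d) × ℝ) : patterns X ⊕ patterns X :=
  if 0 ≤ x.2 then .inl ⟨arrangement X x.1, x.1, rfl⟩ else .inr ⟨arrangement X x.1, x.1, rfl⟩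

theorem blockPattern_neuronBlock (x : EuclideanSpace ℝ (Fin d) × ℝ) :
    (blockPattern (neuronBlock X x)).1 = arrangement X x.1 := by
  rw [neuronBlock]
  split_ifs <;> rfl

theorem blockSign_mul_abs (x : EuclideanSpace ℝ (Fin d) × ℝ) :
    blockSign (neuronBlock X x) * |x.2| = x.2 := by
  rw [neuronBlock]
  split_ifs with h
  · simp [blockSign, abs_of_nonneg h]
  · simp [blockSign, abs_of_neg (not_le.1 h)]

theorem mem_cone_neuronBlock (x : EuclideanSpace ℝ (Fin d) × ℝ) :
    x.1 ∈ (lasso X hℓ hβ).cone (neuronBlock X x) := by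
  change x.1 ∈ patternCone X (blockPattern (neuronBlock X x)).1
  rw [blockPattern_neuronBlock]
  exact mem_patternCone_arrangement x.1

variable (X) in
/-- The blocks of the convex reformulation obtained by merging the neurons of each block. -/
def liftBlocks (k : patterns X ⊕ patterns X) : EuclideanSpace ℝ (Fin d) :=
  open Classical in ∑ j with neuronBlock X (θ j) = k, |(θ j).2| • (θ j).1

theorem liftBlocks_mem_cone (k : patterns X ⊕ patterns X) :
    liftBlocks X θ k ∈ (lasso X hℓ hβ).cone k := by
  classical
  refine Finset.sum_induction _ (· ∈ (lasso X hℓ hβ).cone k) (ConeLasso.add_mem _ _)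
    (ConeLasso.zero_mem _ _) fun j hj => ?_
  rw [← (Finset.mem_filter.1 hj).2]
  exact ConeLasso.smul_mem _ _ _ _ (abs_nonneg _) (mem_cone_neuronBlock _)

theorem fit_liftBlocks : (lasso X hℓ hβ).fit (liftBlocks X θ) = networkFit X θ := by
  classical
  rw [ConeLasso.fit_apply, networkFit, ← Finset.sum_fiberwise Finset.univ
    fun j => neuronBlock X (θ j)]
  refine Finset.sum_congr rfl fun k _ => ?_
  rw [liftBlocks, map_sum]
  refine Finset.sum_congr (by congr) fun j hj => ?_
  rw [← (Finset.mem_filter.1 hj).2, map_smul, lasso_design_of_mem (mem_cone_neuronBlock _),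
    smul_smul, mul_comm, blockSign_mul_abs]

theorem norm_liftBlocks_le (k : patterns X ⊕ patterns X) :
    ‖liftBlocks X θ k‖ ≤
      open Classical in ∑ j with neuronBlock X (θ j) = k, |(θ j).2| * ‖(θ j).1‖ := by
  refine (norm_sum_le _ _).trans_eq (Finset.sum_congr rfl fun j _ => ?_)
  rw [norm_smul, Real.norm_eq_abs, abs_abs]

theorem sum_norm_liftBlocks_le :
    ∑ k, ‖liftBlocks X θ k‖ ≤ ∑ j, |(θ j).2| * ‖(θ j).1‖ := by
  classical
  rw [← Finset.sum_fiberwise Finset.univ fun j => neuronBlock X (θ j)]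
  refine Finset.sum_le_sum fun k _ => (norm_liftBlocks_le θ k).trans_eq ?_
  congr

theorem sum_mul_le :
    ∑ j, |(θ j).2| * ‖(θ j).1‖ ≤ 1 / 2 * ∑ j, (‖(θ j).1‖ ^ 2 + (θ j).2 ^ 2) := by
  rw [Finset.mul_sum]
  refine Finset.sum_le_sum fun j _ => ?_
  have := sq_nonneg (‖(θ j).1‖ - |(θ j).2|)
  rw [← sq_abs (θ j).2]
  linarith

variable {L : (Fin n → ℝ) → (Fin n → ℝ) → ℝ} {y : Fin n → ℝ}
  {hL : StrictConvexOn ℝ Set.univ fun z => L z y}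

/-- The fit is unchanged; the penalty drops by the triangle inequality in each block and by `2|α|‖w‖
≤ ‖w‖² + α²` for each neuron. -/
theorem objective_liftBlocks_le :
    (lasso X hL hβ).objective (liftBlocks X θ) ≤ trainingObjective L X y β θ := by
  have h := mul_le_mul_of_nonneg_left ((sum_norm_liftBlocks_le (X := X) θ).trans (sum_mul_le θ))
    hβ.le
  rw [ConeLasso.objective, trainingObjective, fit_liftBlocks]
  change L _ _ + β * _ ≤ _
  linarith

variable {θ}

/-- Every neuron of a network that is as good as the convex reformulation is balanced and
aligned with an active direction. -/
theorem neuron_eq_of_trainingObjective_le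
    {q : patterns X ⊕ patterns X → EuclideanSpace ℝ (Fin d)} (hq : q ∈ (lasso X hL hβ).optimal)
    (hθ : trainingObjective L X y β θ ≤ (lasso X hL hβ).objective q) (j : Fin m) :
    θ j = 0 ∨ ∃ a : (lasso X hL hβ).Atom,
      θ j = (‖(θ j).1‖ • (lasso X hL hβ).dir a, blockSign a.1 * ‖(θ j).1‖) := by
  classical
  have hlift : liftBlocks X θ ∈ (lasso X hL hβ).optimal :=
    ⟨liftBlocks_mem_cone θ, fun q' hq' =>
      ((objective_liftBlocks_le θ).trans hθ).trans (hq.2 q' hq')⟩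
  have hobj : trainingObjective L X y β θ ≤ (lasso X hL hβ).objective (liftBlocks X θ) :=
    hθ.trans (hq.2 _ hlift.1)
  have h1 := sum_norm_liftBlocks_le (X := X) θ
  have h2 := sum_mul_le θ
  -- This closes the chain formed by `h1` and `h2`, so both are equalities: the second gives
  -- balance, the first alignment.
  have h3 : 1 / 2 * ∑ j, (‖(θ j).1‖ ^ 2 + (θ j).2 ^ 2) ≤ ∑ k, ‖liftBlocks X θ k‖ := by
    rw [ConeLasso.objective, trainingObjective, fit_liftBlocks] at hobj
    change _ ≤ L _ _ + β * _ at hobj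
    refine le_of_mul_le_mul_left ?_ hβ
    linarith
  have hbal : |(θ j).2| = ‖(θ j).1‖ := by
    have h4 : ∑ j, (‖(θ j).1‖ - |(θ j).2|) ^ 2 = 0 := by
      refine le_antisymm ?_ (Finset.sum_nonneg fun _ _ => sq_nonneg _)
      have h5 : ∑ j, (‖(θ j).1‖ - |(θ j).2|) ^ 2 =
          ∑ j, (‖(θ j).1‖ ^ 2 + (θ j).2 ^ 2) - 2 * ∑ j, |(θ j).2| * ‖(θ j).1‖ := by
        rw [Finset.mul_sum, ← Finset.sum_sub_distrib]
        refine Finset.sum_congr rfl fun j _ => ?_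
        rw [← sq_abs (θ j).2]
        ring
      linarith
    have h6 := (Finset.sum_eq_zero_iff_of_nonneg fun _ _ => sq_nonneg _).1 h4 j (Finset.mem_univ j)
    exact (sub_eq_zero.1 (pow_eq_zero_iff two_ne_zero |>.1 h6)).symm
  by_cases hw : ‖(θ j).1‖ = 0
  · left
    rw [hw, abs_eq_zero] at hbal
    exact Prod.ext (norm_eq_zero.1 hw) hbal
  right
  set k := neuronBlock X (θ j) with hk
  have hfib : ∑ i with neuronBlock X (θ i) = k, |(θ i).2| * ‖(θ i).1‖ = ‖liftBlocks X θ k‖ := by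
    have h7 : ∑ k, ‖liftBlocks X θ k‖ =
        ∑ k, ∑ i with neuronBlock X (θ i) = k, |(θ i).2| * ‖(θ i).1‖ := by
      rw [Finset.sum_fiberwise]
      linarith
    refine ((Finset.sum_eq_sum_iff_of_le fun k _ => ?_).1 h7 k (Finset.mem_univ k)).symm
    exact (norm_liftBlocks_le θ k).trans_eq (by congr)
  have hjk : j ∈ Finset.univ.filter fun i => neuronBlock X (θ i) = k := by simp [hk]
  have hpos : 0 < ‖(θ j).1‖ := lt_of_le_of_ne (norm_nonneg _) (Ne.symm hw)
  have hact : (lasso X hL hβ).Active k := by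
    refine ⟨_, hlift, fun h0 => ?_⟩
    rw [h0, norm_zero, Finset.sum_eq_zero_iff_of_nonneg fun i _ => by positivity] at hfib
    have := hfib j hjk
    rw [hbal] at this
    exact (mul_pos hpos hpos).ne' this
  let a : (lasso X hL hβ).Atom := ⟨k, hact⟩
  -- Alignment is the equality case of Cauchy–Schwarz against the unit direction: the bounds summed
  -- over the block are attained, hence each one is.
  have hin : ∀ i, inner ℝ ((lasso X hL hβ).dir k) (|(θ i).2| • (θ i).1) ≤
      |(θ i).2| * ‖(θ i).1‖ := fun i => by
    have := real_inner_le_norm ((lasso X hL hβ).dir k) (|(θ i).2| • (θ i).1)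
    rwa [ConeLasso.norm_dir a, one_mul, norm_smul, Real.norm_eq_abs, abs_abs] at this
  have hsum : ∑ i with neuronBlock X (θ i) = k,
      inner ℝ ((lasso X hL hβ).dir k) (|(θ i).2| • (θ i).1) =
      ∑ i with neuronBlock X (θ i) = k, |(θ i).2| * ‖(θ i).1‖ := by
    have h8 : inner ℝ ((lasso X hL hβ).dir k) (liftBlocks X θ k) = ‖liftBlocks X θ k‖ := by
      conv_lhs => rw [ConeLasso.eq_smul_dir hlift k]
      rw [real_inner_smul_right, real_inner_self_eq_norm_sq, ConeLasso.norm_dir a]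
      ring
    rw [hfib, ← h8, ← inner_sum]
    congr 1
  have hinj := (Finset.sum_eq_sum_iff_of_le fun i _ => hin i).1 hsum j hjk
  have hdir : (θ j).1 = ‖(θ j).1‖ • (lasso X hL hβ).dir k := by
    rw [real_inner_smul_right] at hinj
    have h9 := mul_left_cancel₀ (hbal ▸ hw) hinj
    have h10 := (inner_eq_norm_mul_iff_real (x := (lasso X hL hβ).dir k) (y := (θ j).1)).1 (by
      rw [h9, ConeLasso.norm_dir a, one_mul])
    rw [ConeLasso.norm_dir a, one_smul] at h10
    exact h10.symm
  exact ⟨a, Prod.ext hdir (by rw [← hbal]; exact (blockSign_mul_abs (X := X) (θ j)).symm)⟩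

theorem networkFit_params (hne : (lasso X hL hβ).optimal.Nonempty)
    {s : Fin m → (lasso X hL hβ).Atom} {w : Fin m → ℝ} (hw : ∀ j, 0 ≤ w j) :
    networkFit X ((neuronModel hne).params s w) = ∑ j, w j • (lasso X hL hβ).atomFit (s j) :=
  Finset.sum_congr rfl fun j _ => (neuronModel hne).output_curve (s j) (w j) (hw j)

/-- A balanced neuron of weight `w j` contributes `2 * w j` to the squared norms, and the total
weight is the common total norm of optimal solutions. -/
theorem trainingObjective_of_mem_configs
    {q : patterns X ⊕ patterns X → EuclideanSpace ℝ (Fin d)} (hq : q ∈ (lasso X hL hβ).optimal)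
    (hθ : θ ∈ (neuronModel (Set.nonempty_of_mem hq)).configs ((lasso X hL hβ).fit q) m) :
    trainingObjective L X y β θ = (lasso X hL hβ).objective q := by
  obtain ⟨s, w, hw, rfl⟩ := NeuronModel.exists_of_mem _ hθ
  have h1 := ConeLasso.sum_weights_eq hq ((neuronModel (Set.nonempty_of_mem hq)).total_mem hw)
  have h2 := NeuronModel.sum_total (fun _ => (1 : ℝ)) s w
  simp only [smul_eq_mul, mul_one] at h2
  have h3 : ∀ j, ‖((neuronModel (Set.nonempty_of_mem hq)).params s w j).1‖ ^ 2 +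
      ((neuronModel (Set.nonempty_of_mem hq)).params s w j).2 ^ 2 = 2 * w j := fun j => by
    change ‖√(w j) • (lasso X hL hβ).dir (s j)‖ ^ 2 + (blockSign (s j).1 * √(w j)) ^ 2 = _
    rw [sqrt_smul_norm_sq (ConeLasso.norm_dir _) (hw.1 j), mul_pow, Real.sq_sqrt (hw.1 j), sq,
      blockSign_mul_self]
    ring
  rw [trainingObjective, networkFit_params _ hw.1, Finset.sum_congr rfl fun j _ => h3 j,
    ← Finset.mul_sum, ← h2, h1, ConeLasso.objective]
  change L _ _ + _ = L _ _ + β * _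
  rw [← hw.2]
  simp only [neuronModel, Function.comp_apply]
  ring

theorem configs_subset_optimalParams
    {q : patterns X ⊕ patterns X → EuclideanSpace ℝ (Fin d)} (hq : q ∈ (lasso X hL hβ).optimal) :
    (neuronModel (Set.nonempty_of_mem hq)).configs ((lasso X hL hβ).fit q) m ⊆ optimalParams L X y β m :=
  fun _ hθ θ' => (trainingObjective_of_mem_configs hq hθ).trans_le
    ((hq.2 _ (liftBlocks_mem_cone θ')).trans (objective_liftBlocks_le θ'))

/-- A configuration attains the convex optimum at width `m`, so every minimizer is an equality case
of the merging bound. -/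
theorem optimalParams_eq_configs [Nonempty (lasso X hL hβ).Atom]
    {q : patterns X ⊕ patterns X → EuclideanSpace ℝ (Fin d)} (hq : q ∈ (lasso X hL hβ).optimal)
    (hne : ((neuronModel (Set.nonempty_of_mem hq)).configs ((lasso X hL hβ).fit q) m).Nonempty) :
    optimalParams L X y β m = (neuronModel (Set.nonempty_of_mem hq)).configs ((lasso X hL hβ).fit q) m := by
  refine Set.Subset.antisymm (fun θ hθ => ?_) (configs_subset_optimalParams hq)
  obtain ⟨θ₀, hθ₀⟩ := hne
  have hle : trainingObjective L X y β θ ≤ (lasso X hL hβ).objective q :=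
    (hθ θ₀).trans_eq (trainingObjective_of_mem_configs hq hθ₀)
  have hlift : liftBlocks X θ ∈ (lasso X hL hβ).optimal :=
    ⟨liftBlocks_mem_cone θ, fun q' hq' =>
      ((objective_liftBlocks_le θ).trans hle).trans (hq.2 q' hq')⟩
  have h1 : ∀ j, ∃ a : (lasso X hL hβ).Atom,
      θ j = (‖(θ j).1‖ • (lasso X hL hβ).dir a, blockSign a.1 * ‖(θ j).1‖) := fun j => by
    rcases neuron_eq_of_trainingObjective_le hq hle j with h | h
    -- A zero neuron is given an arbitrary type, with weight zero.
    · exact ⟨Classical.arbitrary _, by simp [h, Prod.ext_iff]⟩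
    · exact h
  choose s hs using h1
  have h2 : θ = (neuronModel (Set.nonempty_of_mem hq)).params s fun j => ‖(θ j).1‖ ^ 2 := by
    funext j
    refine (hs j).trans ?_
    simp only [NeuronModel.params, neuronModel, Real.sqrt_sq (norm_nonneg _)]
  rw [h2]
  refine NeuronModel.params_mem _ ⟨fun j => sq_nonneg _, ?_⟩
  rw [ConeLasso.fit_eq hq hlift, fit_liftBlocks]
  conv_rhs => rw [h2]
  rw [networkFit_params _ fun j => sq_nonneg _]
  rfl

theorem optimalParams_eq_singleton [IsEmpty (lasso X hL hβ).Atom]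
    {q : patterns X ⊕ patterns X → EuclideanSpace ℝ (Fin d)} (hq : q ∈ (lasso X hL hβ).optimal) :
    optimalParams L X y β m = {0} := by
  have hq0 : q = 0 := funext fun k =>
    ConeLasso.eq_zero_of_not_active hq fun h => IsEmpty.false (⟨k, h⟩ : (lasso X hL hβ).Atom)
  have h0 : trainingObjective L X y β (0 : Params d m) = (lasso X hL hβ).objective q := by
    rw [hq0, ConeLasso.objective, map_zero]
    simp [trainingObjective, networkFit, lasso]
  ext θ
  refine ⟨fun hθ => funext fun j => ?_, ?_⟩
  · exact (neuron_eq_of_trainingObjective_le hq ((hθ 0).trans_eq h0) j).resolve_right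
      fun ⟨a, _⟩ => IsEmpty.false a
  · rintro rfl θ'
    exact h0.trans_le ((hq.2 _ (liftBlocks_mem_cone θ')).trans (objective_liftBlocks_le θ'))

end Lift

end Link

end ReLUStaircase

end

/-! ### Assembly of the staircase. -/

theorem theoremt2 {n d : ℕ} (X : Matrix (Fin n) (Fin d) ℝ) (y : Fin n → ℝ) (β : ℝ) (hβ : 0 < β)
    (L : (Fin n → ℝ) → (Fin n → ℝ) → ℝ)
    (hL : StrictConvexOn ℝ Set.univ (fun z => L z y))
    (hne : (ReLUStaircase.convexOptimal L X y β).Nonempty)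
    (mStar MStar : ℕ)
    (hm : mStar = ReLUStaircase.minWidth L X y β)
    (hM : MStar = ReLUStaircase.maxWidth L X y β)
    (Θ : (m : ℕ) → Set (ReLUStaircase.Params d m))
    (hΘ : Θ = ReLUStaircase.optimalParams L X y β) :
    -- the critical widths are an attained minimum and an attained maximum
    (IsLeast (ReLUStaircase.card '' ReLUStaircase.irreducibleOptimal L X y β) mStar ∧
      IsGreatest (ReLUStaircase.card '' ReLUStaircase.irreducibleOptimal L X y β) MStar) ∧
    -- (i)
    ((Θ mStar).Nonempty ∧ (Θ mStar).Finite ∧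
      ∀ A ∈ Θ mStar, ∀ A' ∈ Θ mStar, A ≠ A' → ¬ JoinedIn (Θ mStar) A A') ∧
    -- (ii)
    (∀ m, mStar + 1 ≤ m → ∃ A ∈ Θ m, ∃ A' ∈ Θ m,
      (1 ≤ mStar → A ≠ A') ∧ JoinedIn (Θ m) A A') ∧
    -- (iii)
    ((2 ≤ MStar → ¬ IsConnected (Θ MStar)) ∧
      ∃ A ∈ Θ MStar, ∀ A' ∈ Θ MStar, A' ≠ A → ¬ JoinedIn (Θ MStar) A A') ∧
    -- (iv)
    (∀ m, MStar + 1 ≤ m → ∀ A ∈ Θ m,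
      (∀ σ : Equiv.Perm (Fin m), JoinedIn (Θ m) A (A ∘ σ)) ∧
      (1 ≤ mStar → ∃ A' ∈ Θ m, A' ≠ A ∧ JoinedIn (Θ m) A A')) ∧
    -- (v)
    (∀ m, min (mStar + MStar) (n + 1) ≤ m → IsPathConnected (Θ m)) := by
  subst hΘ
  obtain ⟨p, hp⟩ := hne
  rw [ReLUStaircase.mem_convexOptimal_iff (hL := hL) (hβ := hβ)] at hp
  have hcards := ReLUStaircase.card_image_irreducibleOptimal hp
  set N := ReLUStaircase.neuronModel (Set.nonempty_of_mem hp)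
  set z := (ReLUStaircase.lasso X hL hβ).fit (ReLUStaircase.block p)
  have hbdd : BddAbove (N.basicCards z) := ⟨Module.finrank ℝ (Fin n → ℝ), by
    rintro _ ⟨c, hc, rfl⟩
    exact hc.ncard_le⟩
  have hnonempty : (N.basicCards z).Nonempty := by
    obtain ⟨c, hc⟩ := ReLUStaircase.exists_isBasic
      ⟨_, ReLUStaircase.ConeLasso.norm_mem_conicReps hp hp⟩
    exact ⟨_, c, hc, rfl⟩
  have hleast : IsLeast (N.basicCards z) mStar := by
    rw [hm, ReLUStaircase.minWidth, hcards]
    exact ⟨Nat.sInf_mem hnonempty, fun k hk => Nat.sInf_le hk⟩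
  have hgreatest : IsGreatest (N.basicCards z) MStar := by
    rw [hM, ReLUStaircase.maxWidth, hcards]
    exact ⟨Nat.sSup_mem hnonempty hbdd, fun k hk => le_csSup hbdd hk⟩
  have hle : mStar ≤ MStar := hleast.2 hgreatest.1
  refine ⟨by rw [hcards]; exact ⟨hleast, hgreatest⟩, ?_⟩
  -- Without atoms there are no types for the slots and `configs` is empty at positive width; here
  -- the zero network is the only minimizer.
  rcases isEmpty_or_nonempty (ReLUStaircase.lasso X hL hβ).Atom with hempty | hatom
  · have hΘ : ∀ m, ReLUStaircase.optimalParams L X y β m = {0} := fun m =>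
      ReLUStaircase.optimalParams_eq_singleton hp
    have hM0 : MStar = 0 := by
      obtain ⟨c, -, hc⟩ := hgreatest.1
      rw [← hc]
      simp [Set.eq_empty_of_isEmpty]
    have hm0 : mStar = 0 := by omega
    have hpath : ∀ m, IsPathConnected ({0} : Set (ReLUStaircase.Params d m)) := fun m =>
      isPathConnected_singleton 0
    simp only [hΘ]
    refine ⟨⟨Set.singleton_nonempty _, Set.finite_singleton _, ?_⟩, ?_, ⟨by omega, ?_⟩, ?_,
      fun m _ => hpath m⟩
    · rintro A rfl A' rfl h
      exact absurd rfl h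
    · exact fun m _ => ⟨0, rfl, 0, rfl, by omega, JoinedIn.refl rfl⟩
    · exact ⟨0, rfl, fun A' hA' h => absurd hA' h⟩
    · rintro m - A rfl
      exact ⟨fun σ => JoinedIn.refl rfl, by omega⟩
  -- If `z = 0`, zero weights would represent it, so every optimal solution would have total norm
  -- zero and no block could be active.
  have hz : z ≠ 0 := by
    intro h0
    obtain ⟨⟨k, q, hq, hk⟩⟩ := hatom
    have h1 := ReLUStaircase.ConeLasso.sum_weights_eq hq (c := fun _ => 0)
      ⟨fun _ => le_rfl, by
        rw [ReLUStaircase.ConeLasso.fit_eq hq hp]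
        simpa using h0.symm⟩
    rw [Finset.sum_const_zero, eq_comm,
      Finset.sum_eq_zero_iff_of_nonneg fun _ _ => norm_nonneg _] at h1
    exact hk (norm_eq_zero.1 (h1 k (Finset.mem_univ k)))
  have hΘ : ∀ m, mStar ≤ m → ReLUStaircase.optimalParams L X y β m = N.configs z m :=
    fun m hm => ReLUStaircase.optimalParams_eq_configs hp (N.configs_nonempty hleast.1 hm)
  refine ⟨?_, fun m hm => ?_, ?_, fun m hm A hA => ?_, fun m hm => ?_⟩
  · rw [hΘ _ le_rfl]
    have hfin := N.configs_finite hleast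
    exact ⟨N.configs_nonempty hleast.1 le_rfl, hfin,
      fun A _ A' _ hne h => hne (ReLUStaircase.JoinedIn.eq_of_finite hfin h).symm⟩
  · rw [hΘ _ (by omega)]
    obtain ⟨A, hA, h0⟩ := N.exists_eq_zero_of_basicCards hleast.1 hm
    obtain ⟨A', hne, hj⟩ := N.exists_joinedIn_ne_of_eq_zero hz hA h0
    exact ⟨A, hA, A', hj.target_mem, fun _ => hne.symm, hj⟩
  · rw [hΘ _ hle]
    obtain ⟨A, hA, ⟨U, hU, hAU, hsub⟩, h2⟩ := N.exists_isolated hgreatest.1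
    refine ⟨fun h hconn => ?_, A, hA, fun A' _ hne hj => hne
      (ReLUStaircase.JoinedIn.eq_of_isolated hU hAU hsub hj)⟩
    obtain ⟨A', hA', hne⟩ := h2 h
    exact hne (ReLUStaircase.IsPreconnected.eq_of_isolated hconn.isPreconnected hU hA hAU hsub hA')
  · rw [hΘ _ (by omega)] at hA ⊢
    refine ⟨fun σ => N.joinedIn_comp_perm hgreatest hm hA σ, fun _ => ?_⟩
    exact N.exists_joinedIn_ne hz hgreatest hm hA |>.imp fun A' h => ⟨h.2.target_mem, h⟩
  -- In the case `n + 1 ≤ m` this uses `m* ≤ n`, by independence in dimension `n`.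
  · have hm' : mStar ≤ m := by
      obtain ⟨c, hc, hcm⟩ := hleast.1
      have h1 := hc.ncard_le
      have h2 : (Function.support c).ncard = mStar := hcm
      rw [Module.finrank_fin_fun] at h1
      rcases min_le_iff.1 hm with h | h <;> omega
    rw [hΘ _ hm']
    refine N.isPathConnected_configs hz hleast hgreatest ?_
    rwa [Module.finrank_fin_fun]
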